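/- Let $m\ge 2$ and $\omega\in\mathbb{S}^{m-1}=\{x\in\mathbb{R}^m:\|x\|=1\}$, let $0\le p<1$ and put $H_{\omega,p}=\{x\in\mathbb{R}^m:\langle x,\omega\rangle=p\}$. Let $\mathcal{P}(\mathbb{R}^m)=\mathbb{C}[x_1,\dots,x_m]$, let $\mathcal{P}_\ell(\mathbb{R}^m)$ be its subspace of homogeneous polynomials of degree $\ell\in\mathbb{N}_0$, and put $$D_\omega=\Delta_x-\langle\omega,\partial_x\rangle^2,\qquad \Delta_x=\sum_{j=1}^m\partial_{x_j}^2,\qquad \langle\omega,\partial_x\rangle=\sum_{j=1}^m\omega_j\partial_{x_j}.$$ Below, $dS$ is the Euclidean surface measure of the dimension of the region of integration ($m-2$ in (i), where it is the counting measure if $m=2$, and $m-1$ in (ii)–(iv)). All the integrals below converge absolutely, and the following hold. (i) For the sub-sphere $\mathbb{S}_{p,\omega}=\mathbb{S}^{m-1}\cap H_{\omega,p}$ and every $R\in\mathcal{P}(\mathbb{R}^m)$, $$\int_{\mathbb{S}_{p,\omega}}R(x)\,dS_x=\sum_{k=0}^\infty\frac{2\pi^{\frac{m-1}{2}}}{2^{2k}k!\,\Gamma(\frac{m-1}{2}+k)}\,D_\omega^k[R]\Big|_{x=p\omega}\,(1-p^2)^{k+\frac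 m2-1}.$$ (ii) For the sub-ball $\mathbb{B}_{p,\omega}=\{x\in\mathbb{R}^m:\|x\|<1\}\cap H_{\omega,p}$ and every $R\in\mathcal{P}(\mathbb{R}^m)$, $$\int_{\mathbb{B}_{p,\omega}}R(x)\,dS_x=\sum_{k=0}^\infty\frac{\pi^{\frac{m-1}{2}}}{2^{2k}k!\,\Gamma(\frac{m+1}{2}+k)}\,D_\omega^k[R]\Big|_{x=p\omega}\,(1-p^2)^{k+\frac{m-1}2}.$$ (iii) For the upper spherical cap $C_{p,\omega}=\{x\in\mathbb{S}^{m-1}:\langle x,\omega\rangle>p\}$, every $\ell\in\mathbb{N}_0$ and every $R_\ell\in\mathcal{P}_\ell(\mathbb{R}^m)$, $$\int_{C_{p,\omega}}R_\ell(x)\,dS_x=\sum_{k=0}^{\lfloor\ell/2\rfloor}\frac{2\pi^{\frac{m-1}{2}}}{2^{2k}k!\,\Gamma(\frac{m-1}{2}+k)}\,c_{k,\ell}(p)\,D_\omega^k[R_\ell]\Big|_{x=\omega},$$ where, for $0\le 2k\le\ell$, $$c_{k,\ell}(p)=\int_p^1 t^{\ell-2k}(1-t^2)^{k+\frac{m-3}{2}}\,dt=\frac{\Gamma(\frac{\ell+1}{2}-k)\,\Gamma(k+\frac{m-1}{2})}{2\,\Gamma(\frac{\ell+m}{2})}-\frac{p^{\ell-2k+1}}{\ell-2k+1}\,{}_2F_1\!\left(-k-\tfrac{m-3}{2},\tfrac{\ell+1}{2}-k;\tfrac{\ell+3}{2}-k;p^2\right).$$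 (iv) For the lower spherical cap $C'_{p,\omega}=\{x\in\mathbb{S}^{m-1}:\langle x,\omega\rangle<p\}$, every $\ell\in\mathbb{N}_0$ and every $R_\ell\in\mathcal{P}_\ell(\mathbb{R}^m)$, $$\int_{C'_{p,\omega}}R_\ell(x)\,dS_x=\sum_{k=0}^{\lfloor\ell/2\rfloor}\frac{2\pi^{\frac{m-1}{2}}}{2^{2k}k!\,\Gamma(\frac{m-1}{2}+k)}\,c'_{k,\ell}(p)\,D_\omega^k[R_\ell]\Big|_{x=\omega},$$ where, for $0\le 2k\le\ell$, $$c'_{k,\ell}(p)=\int_{-1}^p t^{\ell-2k}(1-t^2)^{k+\frac{m-3}{2}}\,dt=\frac{p^{\ell-2k+1}}{\ell-2k+1}\,{}_2F_1\!\left(-k-\tfrac{m-3}{2},\tfrac{\ell+1}{2}-k;\tfrac{\ell+3}{2}-k;p^2\right)+(-1)^\ell\,\frac{\Gamma(\frac{\ell+1}{2}-k)\,\Gamma(k+\frac{m-1}{2})}{2\,\Gamma(\frac{\ell+m}{2})}.$$ -/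

import Mathlib

open MeasureTheory
open scoped Real Nat

noncomputable section

namespace SphericalPizzetti

/-- The Laplacian `Δ_x = ∑_j ∂²/∂x_j²` on complex polynomials in `m` real variables. -/
def laplacian (m : ℕ) : Module.End ℂ (MvPolynomial (Fin m) ℂ) :=
  ∑ j : Fin m, (MvPolynomial.pderiv j).toLinearMap ^ 2

/-- The directional derivative `⟨ω, ∂_x⟩ = ∑_j ω_j ∂/∂x_j`. -/
def dirDeriv {m : ℕ} (ω : EuclideanSpace ℝ (Fin m)) : Module.End ℂ (MvPolynomial (Fin m) ℂ) :=
  ∑ j : Fin m, (ω j : ℂ) • (MvPolynomial.pderiv j).toLinearMap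

/-- The operator `Δ_x - ⟨ω, ∂_x⟩²`. -/
def pizzettiOp {m : ℕ} (ω : EuclideanSpace ℝ (Fin m)) : Module.End ℂ (MvPolynomial (Fin m) ℂ) :=
  laplacian m - dirDeriv ω ^ 2

/-- The value of a complex polynomial at a point of `ℝ^m`. -/
def evalAt {m : ℕ} (R : MvPolynomial (Fin m) ℂ) (x : EuclideanSpace ℝ (Fin m)) : ℂ :=
  MvPolynomial.eval (fun j => (x j : ℂ)) R

/-- The hyperplane `⟨x, ω⟩ = p`. -/
def hyperplane {m : ℕ} (ω : EuclideanSpace ℝ (Fin m)) (p : ℝ) :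
    Set (EuclideanSpace ℝ (Fin m)) :=
  {x | inner ℝ x ω = p}

/-- The sub-sphere cut from the unit sphere by the hyperplane `⟨x, ω⟩ = p`. -/
def subSphere {m : ℕ} (ω : EuclideanSpace ℝ (Fin m)) (p : ℝ) :
    Set (EuclideanSpace ℝ (Fin m)) :=
  Metric.sphere 0 1 ∩ hyperplane ω p

/-- The sub-ball cut from the open unit ball by the hyperplane `⟨x, ω⟩ = p`. -/
def subBall {m : ℕ} (ω : EuclideanSpace ℝ (Fin m)) (p : ℝ) :
    Set (EuclideanSpace ℝ (Fin m)) :=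
  Metric.ball 0 1 ∩ hyperplane ω p

/-- The upper spherical cap `⟨x, ω⟩ > p`. -/
def upperCap {m : ℕ} (ω : EuclideanSpace ℝ (Fin m)) (p : ℝ) :
    Set (EuclideanSpace ℝ (Fin m)) :=
  {x ∈ Metric.sphere 0 1 | p < inner ℝ x ω}

/-- The lower spherical cap `⟨x, ω⟩ < p`. -/
def lowerCap {m : ℕ} (ω : EuclideanSpace ℝ (Fin m)) (p : ℝ) :
    Set (EuclideanSpace ℝ (Fin m)) :=
  {x ∈ Metric.sphere 0 1 | inner ℝ x ω < p}

/-- The density `t^(ℓ-2k) (1-t²)^(k+(m-3)/2)`, used for `2k ≤ ℓ` and `-1 ≤ t ≤ 1`. -/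
def capDensity (m k ℓ : ℕ) (t : ℝ) : ℝ :=
  t ^ (ℓ - 2 * k) * (1 - t ^ 2) ^ ((k : ℝ) + ((m : ℝ) - 3) / 2)

/-- `c_{k,ℓ}(p) = ∫_p^1 t^(ℓ-2k) (1-t²)^(k+(m-3)/2) dt`. -/
def upperCoeff (m k ℓ : ℕ) (p : ℝ) : ℝ :=
  ∫ t in p..1, capDensity m k ℓ t

/-- `c'_{k,ℓ}(p) = ∫_{-1}^p t^(ℓ-2k) (1-t²)^(k+(m-3)/2) dt`. -/
def lowerCoeff (m k ℓ : ℕ) (p : ℝ) : ℝ :=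
  ∫ t in (-1)..p, capDensity m k ℓ t

end SphericalPizzetti

end

/-!
# Pizzetti formulas on sub-spheres, sub-balls and spherical caps

All four formulas reduce to Pizzetti's formula on a full sphere centred at the origin of `ℝⁿ`,
where `n + 1` is the dimension of the ambient space.

*Surface measure.* The surface measure of the statement is the normalized Hausdorff measure, whereas
polar coordinates use the cone measure `Measure.toSphere`. The two agree
(`euclideanHausdorffMeasure_sphere`): near a point `x` of the sphere the map `flattenSphere x`
distorts distances by a factor close to `1`, flattens the sphere, and carries a thin spherical shell
over `A` to a cylinder over the flattened `A`, so both measures are close to Lebesgue measure of the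
flattened set. A countable cover and a limit in the distortion finish the argument.

*Full spheres.* For a polynomial `Q` homogeneous of degree `ℓ`, integration by parts against
`exp (-‖x‖²)` and Euler's identity give `∫ ΔQ e^{-‖x‖²} = 2ℓ ∫ Q e^{-‖x‖²}`
(`gaussIntegral_laplacian`). Iterating reduces the Gaussian integral to the value of a power of the
Laplacian at the origin, and polar coordinates turn it into the integral over the sphere
(`hasSum_integral_toSphere`).

*Sub-spheres and sub-balls.* In orthonormal coordinates `y` of the hyperplane, `Δ - ⟨ω, ∂⟩²` is the
Laplacian in `y` (`laplacian_affineSubst`), so the formulas on the sub-sphere and the sub-ball are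
those for the sphere and the ball of radius `√(1 - p²)` in `ℝⁿ`.

*Caps.* After multiplication by a radial Gaussian integral, the integral of a homogeneous polynomial
over a cap becomes an integral over a cone in `ℝⁿ⁺¹`. Fubini's theorem slices it by hyperplanes
orthogonal to `ω`, in each of which the formula for full spheres applies; what remains is an integral
over a half-plane, evaluated in plane polar coordinates (`integral_halfPlane`,
`integral_toSphere_weight`). The same planar integral yields the beta integral in the coefficients,
and the incomplete beta integral is obtained by integrating the binomial series termwise
(`integral_zero_density`).
-/

section PizzettiProof

open scoped Pointwise NNReal ENNReal Topology

/-! ### Hausdorff measure on the unit sphere -/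

/-- If every point has a neighbourhood on whose measurable subsets `μ ≤ c ν`, then `μ ≤ c ν`. -/
theorem MeasureTheory.Measure.le_const_mul_of_locally {X : Type*} [TopologicalSpace X]
    [SecondCountableTopology X] [MeasurableSpace X] [OpensMeasurableSpace X] {μ ν : Measure X}
    {c : ℝ≥0∞}
    (h : ∀ x, ∃ U, IsOpen U ∧ x ∈ U ∧ ∀ A ⊆ U, MeasurableSet A → μ A ≤ c * ν A)
    {A : Set X} (hA : MeasurableSet A) : μ A ≤ c * ν A := by
  choose U hUo hxU hU using h
  obtain ⟨s, hs, hcov⟩ := TopologicalSpace.countable_cover_nhds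
    (fun x => (hUo x).mem_nhds (hxU x))
  rcases s.eq_empty_or_nonempty with rfl | hne
  · simp only [Set.mem_empty_iff_false, Set.iUnion_of_empty, Set.iUnion_empty] at hcov
    have : A = ∅ := Set.eq_empty_of_subset_empty (hcov ▸ Set.subset_univ A)
    simp [this]
  obtain ⟨f, rfl⟩ := hs.exists_eq_range hne
  have hcov' : ⋃ n, disjointed (fun n => U (f n)) n = Set.univ := by
    rw [iUnion_disjointed]; simpa using hcov
  have hm : ∀ n, MeasurableSet (disjointed (fun n => U (f n)) n) :=
    MeasurableSet.disjointed fun n => (hUo (f n)).measurableSet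
  have key : ∀ ρ : Measure X, ρ A = ∑' n, ρ (A ∩ disjointed (fun n => U (f n)) n) := by
    intro ρ
    rw [← measure_iUnion _ fun n => hA.inter (hm n), ← Set.inter_iUnion, hcov', Set.inter_univ]
    exact fun i j hij => ((disjoint_disjointed _) hij).mono Set.inter_subset_right
      Set.inter_subset_right
  rw [key μ, key ν, ← ENNReal.tsum_mul_left]
  gcongr with n
  exact hU (f n) _ (Set.inter_subset_right.trans (disjointed_subset _ n)) (hA.inter (hm n))

theorem LipschitzOnWith.euclideanHausdorffMeasure_image_le {X Y : Type*} [EMetricSpace X]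
    [EMetricSpace Y] [MeasurableSpace X] [BorelSpace X] [MeasurableSpace Y] [BorelSpace Y]
    {K : ℝ≥0} {f : X → Y} {s : Set X} (h : LipschitzOnWith K f s) (d : ℕ) :
    μHE[d] (f '' s) ≤ (K : ℝ≥0∞) ^ d * μHE[d] s := by
  simp only [Measure.euclideanHausdorffMeasure_def, Measure.smul_apply, ENNReal.smul_def,
    smul_eq_mul]
  have := h.hausdorffMeasure_image_le (d := d) (Nat.cast_nonneg d)
  rw [ENNReal.rpow_natCast] at this
  calc _ ≤ _ := mul_le_mul_right this _
    _ = _ := by ring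

section Sphere

variable {E : Type*} [NormedAddCommGroup E] [InnerProductSpace ℝ E]

/-- The map sending `ρ • a`, for `a` in the unit sphere and `ρ > 0`, to `P a + ρ • x`, where `P` is
the orthogonal projection along the unit vector `x`. It flattens the sphere near `x` and turns
spherical shells into cylinders. -/
noncomputable def flattenSphere (x z : E) : E :=
  ‖z‖⁻¹ • (ContinuousLinearMap.id ℝ E - (innerSL ℝ x).smulRight x) z + ‖z‖ • x

theorem flattenSphere_smul (x : E) {a : E} (ha : ‖a‖ = 1) {ρ : ℝ} (hρ : 0 < ρ) :
    flattenSphere x (ρ • a) = a - inner ℝ x a • x + ρ • x := by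
  simp [flattenSphere, norm_smul, ha, abs_of_pos hρ, smul_sub, smul_smul, hρ.ne']

theorem hasStrictFDerivAt_norm_of_norm_eq_one {x : E} (hx : ‖x‖ = 1) :
    HasStrictFDerivAt (fun z : E => ‖z‖) (innerSL ℝ x) x := by
  have h := (hasStrictFDerivAt_norm_sq x).sqrt (by simp [hx])
  have e : (fun z : E => √(‖z‖ ^ 2)) = fun z => ‖z‖ := by ext z; simp
  rw [e] at h
  convert h using 1
  ext z
  simp [hx]

/-- Near `x` the flattening map is an approximate isometry. -/
theorem hasStrictFDerivAt_flattenSphere {x : E} (hx : ‖x‖ = 1) :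
    HasStrictFDerivAt (flattenSphere x) (ContinuousLinearMap.id ℝ E) x := by
  have hn := hasStrictFDerivAt_norm_of_norm_eq_one hx
  have hi := (hasStrictDerivAt_inv (x := ‖x‖) (by simp [hx])).comp_hasStrictFDerivAt x hn
  have h := (hi.fun_smul
    (ContinuousLinearMap.id ℝ E - (innerSL ℝ x).smulRight x).hasStrictFDerivAt).add
    (hn.fun_smul (hasStrictFDerivAt_const x x))
  refine h.congr_fderiv ?_
  ext z
  simp [hx]

theorem exists_ball_flattenSphere_lipschitz {x : E} (hx : ‖x‖ = 1) {K : ℝ≥0} (hK : 1 < K) :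
    ∃ r > 0, LipschitzOnWith K (flattenSphere x) (Metric.ball x r) ∧
      ∀ y ∈ Metric.ball x r, ∀ z ∈ Metric.ball x r,
        dist y z ≤ K * dist (flattenSphere x y) (flattenSphere x z) := by
  -- an error `c` with `1 + c ≤ K` and `1 / (1 - c) = K`
  have hK' : (1 : ℝ) < K := by exact_mod_cast hK
  set c : ℝ≥0 := ⟨1 - (K : ℝ)⁻¹, by
    have := inv_lt_one_of_one_lt₀ hK'; linarith⟩ with hc
  have hcv : (c : ℝ) = 1 - (K : ℝ)⁻¹ := rfl
  have hc0 : 0 < c := by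
    rw [← NNReal.coe_pos, hcv]; have := inv_lt_one_of_one_lt₀ hK'; linarith
  obtain ⟨s, hs, h⟩ := (hasStrictFDerivAt_flattenSphere hx).approximates_deriv_on_nhds
    (c := c) (Or.inr hc0)
  obtain ⟨r, hr, hrs⟩ := Metric.mem_nhds_iff.1 hs
  have key : ∀ y ∈ Metric.ball x r, ∀ z ∈ Metric.ball x r,
      ‖(flattenSphere x y - flattenSphere x z) - (y - z)‖ ≤ c * ‖y - z‖ := by
    intro y hy z hz
    simpa using h y (hrs hy) z (hrs hz)
  have hinv : (K : ℝ) * (K : ℝ)⁻¹ = 1 := mul_inv_cancel₀ (by positivity)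
  refine ⟨r, hr, LipschitzOnWith.of_dist_le_mul fun y hy z hz => ?_, fun y hy z hz => ?_⟩
  · rw [dist_eq_norm, dist_eq_norm]
    have h1 := key y hy z hz
    have h2 := norm_sub_norm_le (flattenSphere x y - flattenSphere x z) (y - z)
    have h3 : 1 + (c : ℝ) ≤ K := by
      rw [hcv]; nlinarith [sq_nonneg ((K : ℝ) - 1), inv_pos.2 (zero_lt_one.trans hK')]
    nlinarith [norm_nonneg (y - z)]
  · rw [dist_eq_norm, dist_eq_norm]
    have h1 := key y hy z hz
    have h2 := norm_sub_norm_le (y - z) (flattenSphere x y - flattenSphere x z)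
    rw [norm_sub_rev (y - z)] at h2
    have h4 : (K : ℝ)⁻¹ * ‖y - z‖ ≤ ‖flattenSphere x y - flattenSphere x z‖ := by
      rw [hcv] at h1; linarith
    calc ‖y - z‖ = K * ((K : ℝ)⁻¹ * ‖y - z‖) := by rw [← mul_assoc, hinv, one_mul]
      _ ≤ _ := by gcongr

variable [MeasurableSpace E] [BorelSpace E]

theorem euclideanHausdorffMeasure_flattenSphere_image {x : E} {K : ℝ≥0} {s : Set E}
    (h1 : LipschitzOnWith K (flattenSphere x) s)
    (h2 : ∀ y ∈ s, ∀ z ∈ s, dist y z ≤ K * dist (flattenSphere x y) (flattenSphere x z))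
    {A : Set E} (hA : A ⊆ s) (d : ℕ) :
    μHE[d] (flattenSphere x '' A) ≤ (K : ℝ≥0∞) ^ d * μHE[d] A ∧
      μHE[d] A ≤ (K : ℝ≥0∞) ^ d * μHE[d] (flattenSphere x '' A) := by
  refine ⟨(h1.mono hA).euclideanHausdorffMeasure_image_le d, ?_⟩
  have hinj : Set.InjOn (flattenSphere x) A := by
    intro y hy z hz hyz
    have := h2 y (hA hy) z (hA hz)
    rw [hyz, dist_self, mul_zero] at this
    exact dist_le_zero.1 this
  have hl : LipschitzOnWith K (Function.invFunOn (flattenSphere x) A) (flattenSphere x '' A) := by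
    refine LipschitzOnWith.of_dist_le_mul ?_
    rintro _ ⟨y, hy, rfl⟩ _ ⟨z, hz, rfl⟩
    rw [hinj.leftInvOn_invFunOn hy, hinj.leftInvOn_invFunOn hz]
    exact h2 y (hA hy) z (hA hz)
  have := hl.euclideanHausdorffMeasure_image_le d
  rwa [hinj.leftInvOn_invFunOn.image_image] at this

variable [FiniteDimensional ℝ E]

/-- The volume of a flattened shell, by slicing orthogonally to `x`. -/
theorem volume_flattenSphere_shell {x : E} (hx : ‖x‖ = 1) {A : Set E}
    (hA : A ⊆ Metric.sphere 0 1) (δ : ℝ)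
    (hm : MeasurableSet (flattenSphere x '' (Set.Ioo (1 : ℝ) (1 + δ) • A))) :
    μHE[Module.finrank ℝ E] (flattenSphere x '' (Set.Ioo (1 : ℝ) (1 + δ) • A)) =
      ENNReal.ofReal δ * μHE[Module.finrank ℝ E - 1] (flattenSphere x '' A) := by
  have hx0 : x ≠ 0 := by rintro rfl; simp at hx
  have hxx : inner ℝ x x = 1 := by simp [hx]
  rw [EuclideanGeometry.euclideanHausdorffMeasure_eq_lintegral (0 : E) hx0 hm]
  have hF : ∀ a ∈ A, ∀ ρ : ℝ, 0 < ρ →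
      flattenSphere x (ρ • a) = (ρ - 1) • x + flattenSphere x a := by
    intro a ha ρ hρ
    have ha1 : ‖a‖ = 1 := by simpa using hA ha
    have h1 := flattenSphere_smul x ha1 one_pos
    rw [one_smul] at h1
    rw [flattenSphere_smul x ha1 hρ, h1, sub_smul]
    abel
  have hin : ∀ a ∈ A, inner ℝ x (flattenSphere x a) = 1 := by
    intro a ha
    have ha1 : ‖a‖ = 1 := by simpa using hA ha
    have h1 := flattenSphere_smul x ha1 one_pos
    rw [one_smul] at h1
    rw [h1, inner_add_right, inner_sub_right, inner_smul_right, inner_smul_right, hxx]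
    ring
  have hmem : ∀ (t : ℝ) (y : E),
      y ∈ (AffineSubspace.mk' (t • x +ᵥ (0 : E)) (ℝ ∙ x)ᗮ : Set E) ↔ inner ℝ x y = t := by
    intro t y
    rw [SetLike.mem_coe, AffineSubspace.mem_mk', Submodule.mem_orthogonal_singleton_iff_inner_right]
    simp only [vadd_eq_add, add_zero, vsub_eq_sub, inner_sub_right, inner_smul_right, hxx]
    constructor <;> intro h <;> linarith
  have hslice : ∀ t : ℝ, μHE[Module.finrank ℝ E - 1]
      (flattenSphere x '' (Set.Ioo (1 : ℝ) (1 + δ) • A) ∩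
        AffineSubspace.mk' (t • x +ᵥ (0 : E)) (ℝ ∙ x)ᗮ) =
      (Set.Ioo (1 : ℝ) (1 + δ)).indicator
        (fun _ => μHE[Module.finrank ℝ E - 1] (flattenSphere x '' A)) t := by
    intro t
    by_cases ht : t ∈ Set.Ioo (1 : ℝ) (1 + δ)
    · rw [Set.indicator_of_mem ht,
        ← measure_vadd _ ((t - 1) • x) (flattenSphere x '' A)]
      congr 1
      ext y
      rw [Set.mem_inter_iff, hmem, Set.mem_vadd_set]
      constructor
      · rintro ⟨⟨_, ⟨ρ, hρ, a, ha, rfl⟩, rfl⟩, h⟩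
        have hρ0 : 0 < ρ := zero_lt_one.trans hρ.1
        simp only [hF a ha ρ hρ0, inner_add_right, inner_smul_right, hxx, hin a ha] at h
        refine ⟨flattenSphere x a, ⟨a, ha, rfl⟩, ?_⟩
        simp only [hF a ha ρ hρ0, vadd_eq_add]
        congr 3
        linarith
      · rintro ⟨_, ⟨a, ha, rfl⟩, rfl⟩
        refine ⟨⟨t • a, ⟨t, ht, a, ha, rfl⟩, ?_⟩, ?_⟩
        · rw [hF a ha t (zero_lt_one.trans ht.1), vadd_eq_add]
        · simp [inner_add_right, inner_smul_right, hin a ha, hx]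
    · rw [Set.indicator_of_notMem ht]
      refine Eq.trans (congrArg _ ?_) measure_empty
      rw [Set.eq_empty_iff_forall_notMem]
      rintro y ⟨⟨_, ⟨ρ, hρ, a, ha, rfl⟩, rfl⟩, h⟩
      rw [hmem] at h
      simp only [hF a ha ρ (zero_lt_one.trans hρ.1), inner_add_right, inner_smul_right, hxx,
        hin a ha] at h
      apply ht
      convert hρ using 1
      linarith
  simp_rw [hslice]
  rw [lintegral_indicator measurableSet_Ioo, setLIntegral_const, Real.volume_Ioo,
    ← ofReal_norm, hx]
  simp [mul_comm]

/-- The volume of a thin shell over `A`, in terms of the cone measure on the sphere. -/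
theorem volume_shell_bounds [Nontrivial E] {A : Set (Metric.sphere (0 : E) 1)}
    (hA : MeasurableSet A) {δ : ℝ} (hδ : 0 ≤ δ) :
    ENNReal.ofReal δ * (volume : Measure E).toSphere A ≤
        (volume : Measure E) (Set.Ioo (1 : ℝ) (1 + δ) • (Subtype.val '' A)) ∧
      (volume : Measure E) (Set.Ioo (1 : ℝ) (1 + δ) • (Subtype.val '' A)) ≤
        ENNReal.ofReal ((1 + δ) ^ Module.finrank ℝ E) * ENNReal.ofReal δ *
          (volume : Measure E).toSphere A := by
  set n := Module.finrank ℝ E with hn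
  set I : Set (Set.Ioi (0 : ℝ)) := Subtype.val ⁻¹' Set.Ioo (1 : ℝ) (1 + δ) with hI
  have hIm : MeasurableSet I := measurable_subtype_coe measurableSet_Ioo
  have hvol : (volume : Measure E) (Set.Ioo (1 : ℝ) (1 + δ) • (Subtype.val '' A)) =
      (volume : Measure E).toSphere A * Measure.volumeIoiPow (n - 1) I := by
    have h := (Measure.measurePreserving_homeomorphUnitSphereProd
      (volume : Measure E)).measure_preimage (hA.prod hIm).nullMeasurableSet
    rw [Measure.prod_prod, comap_subtype_coe_apply (measurableSet_singleton _).compl] at h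
    rw [← h]
    congr 1
    ext y
    constructor
    · rintro ⟨ρ, hρ, _, ⟨a, ha, rfl⟩, rfl⟩
      have hρ0 : 0 < ρ := zero_lt_one.trans hρ.1
      have e := homeomorphUnitSphereProd_symm_apply_coe E (a, ⟨ρ, hρ0⟩)
      refine ⟨(homeomorphUnitSphereProd E).symm (a, ⟨ρ, hρ0⟩), ?_, e⟩
      rw [Set.mem_preimage, Homeomorph.apply_symm_apply]
      exact ⟨ha, hρ⟩
    · rintro ⟨y, hy, rfl⟩
      have e := homeomorphUnitSphereProd_symm_apply_coe E (homeomorphUnitSphereProd E y)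
      rw [Homeomorph.symm_apply_apply] at e
      exact ⟨_, hy.2, _, ⟨_, hy.1, rfl⟩, e.symm⟩
  have hlen : (Measure.comap Subtype.val volume : Measure (Set.Ioi (0 : ℝ))) I
      = ENNReal.ofReal δ := by
    rw [comap_subtype_coe_apply measurableSet_Ioi, hI, Subtype.image_preimage_coe,
      Set.inter_eq_self_of_subset_right
        (show Set.Ioo (1 : ℝ) (1 + δ) ⊆ Set.Ioi 0 from
        fun t ht => Set.mem_Ioi.2 (zero_lt_one.trans ht.1)),
      Real.volume_Ioo]
    simp
  have hw : Measure.volumeIoiPow (n - 1) I =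
      ∫⁻ r in I, ENNReal.ofReal ((r : ℝ) ^ (n - 1)) ∂(Measure.comap Subtype.val volume) := by
    rw [Measure.volumeIoiPow, withDensity_apply _ hIm]
  constructor
  · rw [hvol, mul_comm]
    gcongr
    rw [hw, ← hlen, ← setLIntegral_one]
    refine setLIntegral_mono' hIm fun r hr => ?_
    rw [ENNReal.one_le_ofReal]
    exact one_le_pow₀ hr.1.le
  · rw [hvol, mul_comm]
    gcongr
    rw [hw, ← hlen, ← setLIntegral_const]
    refine setLIntegral_mono' hIm fun r hr => ?_
    gcongr
    calc (r : ℝ) ^ (n - 1) ≤ (1 + δ) ^ (n - 1) := by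
          have := r.2.out.le
          gcongr; exact hr.2.le
      _ ≤ (1 + δ) ^ n := pow_le_pow_right₀ (by linarith) (Nat.sub_le _ _)

/-- The `(n-1)`-dimensional Hausdorff measure on the unit sphere of an `n`-dimensional Euclidean
space is the cone measure `Measure.toSphere`. Near each point both agree, up to a factor close to
`1`, with Lebesgue measure of the flattened set. -/
theorem euclideanHausdorffMeasure_sphere [Nontrivial E] :
    (μHE[Module.finrank ℝ E - 1] : Measure (Metric.sphere (0 : E) 1)) =
      (volume : Measure E).toSphere := by
  set n := Module.finrank ℝ E with hn
  have hvol : (volume : Measure E) = μHE[n] :=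
    InnerProductSpace.euclideanHausdorffMeasure_eq_volume.symm
  have local_bound : ∀ K : ℝ≥0, 1 < K → ∀ x : Metric.sphere (0 : E) 1,
      ∃ U, IsOpen U ∧ x ∈ U ∧ ∀ A ⊆ U, MeasurableSet A →
        (μHE[n - 1] : Measure (Metric.sphere (0 : E) 1)) A ≤
            (K : ℝ≥0∞) ^ (3 * n) * (volume : Measure E).toSphere A ∧
          (volume : Measure E).toSphere A ≤
            (K : ℝ≥0∞) ^ (3 * n) * (μHE[n - 1] : Measure (Metric.sphere (0 : E) 1)) A := by
    intro K hK x
    have hx : ‖(x : E)‖ = 1 := by simp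
    have hK1 : (1 : ℝ≥0∞) ≤ K := by exact_mod_cast hK.le
    obtain ⟨r, hr, h1, h2⟩ := exists_ball_flattenSphere_lipschitz hx hK
    refine ⟨Metric.ball x (r / 2), Metric.isOpen_ball, Metric.mem_ball_self (half_pos hr),
      fun A hAU hA => ?_⟩
    -- a shell so thin that it stays in the ball and has `1 + δ ≤ K`
    set δ : ℝ := min (r / 2) ((K : ℝ) - 1) with hδ
    have hδ0 : 0 < δ := lt_min (half_pos hr) (by have : (1 : ℝ) < K := by exact_mod_cast hK
                                                 linarith)
    have hδr : δ ≤ r / 2 := min_le_left _ _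
    have hδK : 1 + δ ≤ K := by have := min_le_right (r / 2) ((K : ℝ) - 1); linarith
    set A' : Set E := Subtype.val '' A with hA'
    set Sh : Set E := Set.Ioo (1 : ℝ) (1 + δ) • A' with hSh
    have hA'S : A' ⊆ Metric.sphere 0 1 := by rintro _ ⟨a, _, rfl⟩; exact a.2
    have hA'b : A' ⊆ Metric.ball (x : E) r := by
      rintro _ ⟨a, ha, rfl⟩
      have := hAU ha
      rw [Metric.mem_ball] at this ⊢
      exact (this.trans (half_lt_self hr))
    have hShb : Sh ⊆ Metric.ball (x : E) r := by
      rintro _ ⟨ρ, hρ, _, ⟨a, ha, rfl⟩, rfl⟩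
      have h3 := hAU ha
      rw [Metric.mem_ball, Subtype.dist_eq] at h3
      have ha1 : ‖(a : E)‖ = 1 := by simp
      have h4 : dist (ρ • (a : E)) a = ρ - 1 := by
        rw [dist_eq_norm]
        have : ρ • (a : E) - a = (ρ - 1) • (a : E) := by rw [sub_smul, one_smul]
        rw [this, norm_smul, ha1, mul_one, Real.norm_eq_abs, abs_of_pos (by linarith [hρ.1])]
      rw [Metric.mem_ball]
      have h5 := dist_triangle (ρ • (a : E)) a x
      have h6 := hρ.2
      linarith
    have hShm : MeasurableSet Sh := by
      have he : Sh = (fun q : ℝ × E => q.1 • q.2) '' (Set.Ioo (1 : ℝ) (1 + δ) ×ˢ A') := by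
        rw [hSh, Set.image_prod]; rfl
      rw [he]
      refine (measurableSet_Ioo.prod ((MeasurableEmbedding.subtype_coe
        Metric.isClosed_sphere.measurableSet).measurableSet_image.2 hA)).image_of_continuousOn_injOn
        (by fun_prop) ?_
      rintro ⟨s, a⟩ ⟨hs, ha⟩ ⟨t, b⟩ ⟨ht, hb⟩ hst
      simp only at hst hs ht ha hb
      have ha1 : ‖a‖ = 1 := by simpa using hA'S ha
      have hb1 : ‖b‖ = 1 := by simpa using hA'S hb
      have hs0 : 0 < s := zero_lt_one.trans hs.1
      have ht0 : 0 < t := zero_lt_one.trans ht.1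
      have hst' : s = t := by
        have := congrArg norm hst
        simpa [norm_smul, ha1, hb1, abs_of_pos hs0, abs_of_pos ht0] using this
      subst hst'
      rw [smul_right_injective E hs0.ne' hst]
    have hinj : Set.InjOn (flattenSphere (x : E)) Sh := by
      intro y hy z hz hyz
      have := h2 y (hShb hy) z (hShb hz)
      rw [hyz, dist_self, mul_zero] at this
      exact dist_le_zero.1 this
    have hFm : MeasurableSet (flattenSphere (x : E) '' Sh) :=
      hShm.image_of_continuousOn_injOn (h1.continuousOn.mono hShb) hinj
    have hslice := volume_flattenSphere_shell hx hA'S δ hFm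
    obtain ⟨b1, b2⟩ := volume_shell_bounds hA hδ0.le
    obtain ⟨c1, c2⟩ := euclideanHausdorffMeasure_flattenSphere_image h1 h2 hA'b (n - 1)
    obtain ⟨d1, d2⟩ := euclideanHausdorffMeasure_flattenSphere_image h1 h2 hShb n
    rw [hvol] at b1 b2
    have hHA : (μHE[n - 1] : Measure (Metric.sphere (0 : E) 1)) A = μHE[n - 1] A' :=
      (isometry_subtype_coe.euclideanHausdorffMeasure_image A).symm
    rw [hHA, hvol]
    have hδ1 : ENNReal.ofReal δ ≠ 0 := by simpa using hδ0
    have hδ2 : ENNReal.ofReal δ ≠ ∞ := ENNReal.ofReal_ne_top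
    have hpow : (K : ℝ≥0∞) ^ (n - 1) ≤ (K : ℝ≥0∞) ^ n := pow_le_pow_right₀ hK1 (Nat.sub_le _ _)
    have hδK' : ENNReal.ofReal ((1 + δ) ^ n) ≤ (K : ℝ≥0∞) ^ n := by
      rw [ENNReal.ofReal_pow (by linarith)]
      gcongr
      rw [← ENNReal.ofReal_coe_nnreal]
      exact ENNReal.ofReal_le_ofReal hδK
    constructor
    · rw [← ENNReal.mul_le_mul_iff_right hδ1 hδ2]
      calc ENNReal.ofReal δ * μHE[n - 1] A'
          ≤ ENNReal.ofReal δ * ((K : ℝ≥0∞) ^ n * μHE[n - 1] (flattenSphere (x : E) '' A')) := by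
            gcongr; exact c2.trans (by gcongr)
        _ = (K : ℝ≥0∞) ^ n * μHE[n] (flattenSphere (x : E) '' Sh) := by rw [hslice]; ring
        _ ≤ (K : ℝ≥0∞) ^ n * ((K : ℝ≥0∞) ^ n * ((K : ℝ≥0∞) ^ n * ENNReal.ofReal δ *
              (μHE[n] : Measure E).toSphere A)) := by
            gcongr; exact d1.trans (by gcongr; exact b2.trans (by gcongr))
        _ = _ := by ring
    · rw [← ENNReal.mul_le_mul_iff_right hδ1 hδ2]
      calc ENNReal.ofReal δ * (μHE[n] : Measure E).toSphere A
          ≤ (K : ℝ≥0∞) ^ n * μHE[n] (flattenSphere (x : E) '' Sh) := b1.trans d2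
        _ = (K : ℝ≥0∞) ^ n * (ENNReal.ofReal δ * μHE[n - 1] (flattenSphere (x : E) '' A')) := by
            rw [hslice]
        _ ≤ (K : ℝ≥0∞) ^ n * (ENNReal.ofReal δ * ((K : ℝ≥0∞) ^ n * μHE[n - 1] A')) := by
            gcongr; exact c1.trans (by gcongr)
        _ = ENNReal.ofReal δ * ((K : ℝ≥0∞) ^ (2 * n) * μHE[n - 1] A') := by ring
        _ ≤ _ := by
            have : (K : ℝ≥0∞) ^ (2 * n) ≤ (K : ℝ≥0∞) ^ (3 * n) :=
              pow_le_pow_right₀ hK1 (by omega)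
            gcongr
  -- the constants tend to `1`
  have hlim : Filter.Tendsto (fun k : ℕ => ((1 + ((k : ℝ≥0) + 1)⁻¹ : ℝ≥0) : ℝ≥0∞) ^ (3 * n))
      Filter.atTop (𝓝 1) := by
    have h0 : Filter.Tendsto (fun k : ℕ => (1 + ((k : ℝ≥0) + 1)⁻¹ : ℝ≥0)) Filter.atTop (𝓝 1) := by
      have : Filter.Tendsto (fun k : ℕ => ((k : ℝ≥0) + 1)⁻¹) Filter.atTop (𝓝 0) := by
        simpa using tendsto_one_div_add_atTop_nhds_zero_nat (𝕜 := ℝ≥0)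
      simpa using this.const_add 1
    have h1 := ENNReal.tendsto_coe.2 (h0.pow (3 * n))
    simpa using h1
  have hK : ∀ k : ℕ, (1 : ℝ≥0) < 1 + ((k : ℝ≥0) + 1)⁻¹ := fun k => by
    rw [lt_add_iff_pos_right]; positivity
  have concl : ∀ μ ν : Measure (Metric.sphere (0 : E) 1), ∀ A, ν A ≠ ∞ →
      (∀ k : ℕ, μ A ≤ ((1 + ((k : ℝ≥0) + 1)⁻¹ : ℝ≥0) : ℝ≥0∞) ^ (3 * n) * ν A) → μ A ≤ ν A := by
    intro μ ν A hν h
    have h1 := ENNReal.Tendsto.mul_const (b := ν A) hlim (Or.inr hν)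
    rw [one_mul] at h1
    exact ge_of_tendsto' h1 h
  ext A hA
  have hle : (μHE[n - 1] : Measure (Metric.sphere (0 : E) 1)) A ≤
      (volume : Measure E).toSphere A :=
    concl _ _ A (measure_ne_top _ _) fun k => Measure.le_const_mul_of_locally (fun x => by
      obtain ⟨U, hU, hxU, h⟩ := local_bound _ (hK k) x
      exact ⟨U, hU, hxU, fun A hAU hA => (h A hAU hA).1⟩) hA
  refine le_antisymm hle (concl _ _ A (ne_top_of_le_ne_top (measure_ne_top _ _) hle) fun k =>
    Measure.le_const_mul_of_locally (fun x => by
      obtain ⟨U, hU, hxU, h⟩ := local_bound _ (hK k) x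
      exact ⟨U, hU, hxU, fun A hAU hA => (h A hAU hA).2⟩) hA)

end Sphere

namespace SphericalPizzetti

/-! ### Polynomials, homogeneity and differential operators -/

section Polynomial

variable {m n : ℕ}

@[simp] theorem evalAt_add (P Q : MvPolynomial (Fin m) ℂ) (x : EuclideanSpace ℝ (Fin m)) :
    evalAt (P + Q) x = evalAt P x + evalAt Q x := map_add _ _ _

@[simp] theorem evalAt_mul (P Q : MvPolynomial (Fin m) ℂ) (x : EuclideanSpace ℝ (Fin m)) :
    evalAt (P * Q) x = evalAt P x * evalAt Q x := map_mul _ _ _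

@[simp] theorem evalAt_zero (x : EuclideanSpace ℝ (Fin m)) :
    evalAt (0 : MvPolynomial (Fin m) ℂ) x = 0 := map_zero _

@[simp] theorem evalAt_C (a : ℂ) (x : EuclideanSpace ℝ (Fin m)) :
    evalAt (MvPolynomial.C a) x = a := MvPolynomial.eval_C _

@[simp] theorem evalAt_X (j : Fin m) (x : EuclideanSpace ℝ (Fin m)) :
    evalAt (MvPolynomial.X j) x = (x j : ℂ) := MvPolynomial.eval_X _

@[simp] theorem evalAt_smul (a : ℂ) (P : MvPolynomial (Fin m) ℂ) (x : EuclideanSpace ℝ (Fin m)) :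
    evalAt (a • P) x = a * evalAt P x := MvPolynomial.smul_eval _ _ _

@[simp] theorem evalAt_sum {ι : Type*} (s : Finset ι) (P : ι → MvPolynomial (Fin m) ℂ)
    (x : EuclideanSpace ℝ (Fin m)) : evalAt (∑ i ∈ s, P i) x = ∑ i ∈ s, evalAt (P i) x :=
  map_sum _ _ _

theorem continuous_evalAt (R : MvPolynomial (Fin m) ℂ) : Continuous (evalAt R) := by
  induction R using MvPolynomial.induction_on with
  | C a => simpa [funext (evalAt_C a)] using continuous_const
  | add p q hp hq => simpa only [funext (evalAt_add p q)] using hp.fun_add hq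
  | mul_X p j hp =>
    simp only [funext (evalAt_mul p _), evalAt_X]
    exact hp.mul (by fun_prop)

theorem evalAt_smul_of_isHomogeneous {ℓ : ℕ} {R : MvPolynomial (Fin m) ℂ}
    (hR : R.IsHomogeneous ℓ) (t : ℝ) (x : EuclideanSpace ℝ (Fin m)) :
    evalAt R (t • x) = (t : ℂ) ^ ℓ * evalAt R x := by
  simp only [evalAt, MvPolynomial.eval_eq, Finset.mul_sum]
  refine Finset.sum_congr rfl fun d hd => ?_
  have hdeg : d.degree = ℓ := by
    by_contra h
    exact (MvPolynomial.mem_support_iff.1 hd) (hR.coeff_eq_zero h)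
  simp only [PiLp.smul_apply, smul_eq_mul, Complex.ofReal_mul, mul_pow, Finset.prod_mul_distrib,
    Finset.prod_pow_eq_pow_sum]
  rw [← hdeg, Finsupp.degree_apply]
  ring

/-- A monomial is bounded by a power of the Euclidean norm. -/
theorem norm_evalAt_monomial_le (u : Fin m →₀ ℕ) (a : ℂ) (x : EuclideanSpace ℝ (Fin m)) :
    ‖evalAt (MvPolynomial.monomial u a) x‖ ≤ ‖a‖ * ‖x‖ ^ u.degree := by
  rw [evalAt, MvPolynomial.eval_monomial, norm_mul, Finsupp.prod_fintype _ _ (fun i => pow_zero _),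
    norm_prod, Finsupp.degree_eq_sum, ← Finset.prod_pow_eq_pow_sum]
  gcongr with i
  rw [norm_pow, Complex.norm_real]
  gcongr
  exact PiLp.norm_apply_le x i

theorem laplacian_apply (R : MvPolynomial (Fin m) ℂ) :
    laplacian m R = ∑ j, MvPolynomial.pderiv j (MvPolynomial.pderiv j R) := by
  simp [laplacian, LinearMap.sum_apply, pow_two]

theorem dirDeriv_apply (v : EuclideanSpace ℝ (Fin m)) (R : MvPolynomial (Fin m) ℂ) :
    dirDeriv v R = ∑ j, (v j : ℂ) • MvPolynomial.pderiv j R := by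
  simp [dirDeriv, LinearMap.sum_apply]

theorem pizzettiOp_apply (v : EuclideanSpace ℝ (Fin m)) (R : MvPolynomial (Fin m) ℂ) :
    pizzettiOp v R = laplacian m R - dirDeriv v (dirDeriv v R) := by
  simp [pizzettiOp, pow_two]

theorem pizzettiOp_zero : pizzettiOp (0 : EuclideanSpace ℝ (Fin m)) = laplacian m := by
  refine LinearMap.ext fun R => ?_
  simp [pizzettiOp_apply, dirDeriv_apply]

theorem isHomogeneous_dirDeriv {ℓ : ℕ} {R : MvPolynomial (Fin m) ℂ} (hR : R.IsHomogeneous ℓ)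
    (v : EuclideanSpace ℝ (Fin m)) : (dirDeriv v R).IsHomogeneous (ℓ - 1) := by
  rw [dirDeriv_apply]
  refine MvPolynomial.IsHomogeneous.sum _ _ _ fun j _ => ?_
  rw [MvPolynomial.smul_eq_C_mul]
  exact hR.pderiv.C_mul _

theorem isHomogeneous_laplacian {ℓ : ℕ} {R : MvPolynomial (Fin m) ℂ} (hR : R.IsHomogeneous ℓ) :
    (laplacian m R).IsHomogeneous (ℓ - 2) := by
  rw [laplacian_apply]
  exact MvPolynomial.IsHomogeneous.sum _ _ _ fun j _ => hR.pderiv.pderiv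

theorem isHomogeneous_pizzettiOp {ℓ : ℕ} {R : MvPolynomial (Fin m) ℂ} (hR : R.IsHomogeneous ℓ)
    (v : EuclideanSpace ℝ (Fin m)) : (pizzettiOp v R).IsHomogeneous (ℓ - 2) := by
  rw [pizzettiOp_apply]
  exact (isHomogeneous_laplacian hR).sub (isHomogeneous_dirDeriv (isHomogeneous_dirDeriv hR v) v)

theorem pderiv_eq_zero_of_isHomogeneous_zero {R : MvPolynomial (Fin m) ℂ}
    (hR : R.IsHomogeneous 0) (j : Fin m) : MvPolynomial.pderiv j R = 0 := by
  rw [MvPolynomial.totalDegree_eq_zero_iff_eq_C.1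
    ((MvPolynomial.totalDegree_zero_iff_isHomogeneous _).2 hR), MvPolynomial.pderiv_C]

theorem pizzettiOp_eq_zero {ℓ : ℕ} (hℓ : ℓ < 2) {R : MvPolynomial (Fin m) ℂ}
    (hR : R.IsHomogeneous ℓ) (v : EuclideanSpace ℝ (Fin m)) : pizzettiOp v R = 0 := by
  have h0 : ∀ j, (MvPolynomial.pderiv j R).IsHomogeneous 0 := fun j => by
    have h := hR.pderiv (i := j)
    rwa [show ℓ - 1 = 0 by omega] at h
  have h1 : (dirDeriv v R).IsHomogeneous 0 := by
    have h := isHomogeneous_dirDeriv hR v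
    rwa [show ℓ - 1 = 0 by omega] at h
  rw [pizzettiOp_apply, laplacian_apply, dirDeriv_apply v (dirDeriv v R)]
  simp [pderiv_eq_zero_of_isHomogeneous_zero (h0 _), pderiv_eq_zero_of_isHomogeneous_zero h1]

theorem isHomogeneous_pizzettiOp_pow {ℓ : ℕ} {R : MvPolynomial (Fin m) ℂ}
    (hR : R.IsHomogeneous ℓ) (v : EuclideanSpace ℝ (Fin m)) (k : ℕ) :
    ((pizzettiOp v ^ k) R).IsHomogeneous (ℓ - 2 * k) := by
  induction k with
  | zero => simpa using hR
  | succ k ih =>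
    rw [pow_succ', Module.End.mul_apply]
    have := isHomogeneous_pizzettiOp ih v
    rwa [show ℓ - 2 * k - 2 = ℓ - 2 * (k + 1) by omega] at this

theorem pizzettiOp_pow_eq_zero {ℓ : ℕ} {R : MvPolynomial (Fin m) ℂ}
    (hR : R.IsHomogeneous ℓ) (v : EuclideanSpace ℝ (Fin m)) {k : ℕ} (hk : ℓ < 2 * k) :
    (pizzettiOp v ^ k) R = 0 := by
  obtain ⟨k, rfl⟩ : ∃ j, k = j + 1 := ⟨k - 1, by omega⟩
  induction k with
  | zero => simpa using pizzettiOp_eq_zero (by omega) hR v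
  | succ k ih =>
    rw [pow_succ', Module.End.mul_apply]
    rcases lt_or_ge ℓ (2 * (k + 1)) with h | h
    · rw [ih h, map_zero]
    · exact pizzettiOp_eq_zero (by omega) (isHomogeneous_pizzettiOp_pow hR v (k + 1)) v

theorem isHomogeneous_laplacian_pow {ℓ : ℕ} {R : MvPolynomial (Fin m) ℂ}
    (hR : R.IsHomogeneous ℓ) (k : ℕ) : ((laplacian m ^ k) R).IsHomogeneous (ℓ - 2 * k) := by
  rw [← pizzettiOp_zero]; exact isHomogeneous_pizzettiOp_pow hR 0 k

theorem laplacian_pow_eq_zero {ℓ : ℕ} {R : MvPolynomial (Fin m) ℂ}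
    (hR : R.IsHomogeneous ℓ) {k : ℕ} (hk : ℓ < 2 * k) : (laplacian m ^ k) R = 0 := by
  rw [← pizzettiOp_zero]; exact pizzettiOp_pow_eq_zero hR 0 hk

/-- At the origin only the power of the Laplacian of half the degree survives. -/
theorem evalAt_zero_laplacian_pow {ℓ : ℕ} {R : MvPolynomial (Fin m) ℂ}
    (hR : R.IsHomogeneous ℓ) {k : ℕ} (hk : ℓ ≠ 2 * k) :
    evalAt ((laplacian m ^ k) R) 0 = 0 := by
  rcases lt_or_ge ℓ (2 * k) with h | h
  · rw [laplacian_pow_eq_zero hR h, evalAt_zero]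
  · have h1 := evalAt_smul_of_isHomogeneous (isHomogeneous_laplacian_pow hR k) 0 0
    rw [smul_zero, Complex.ofReal_zero, zero_pow (by omega), zero_mul] at h1
    exact h1

/-- The derivative of the polynomial function is given by the formal directional derivative. -/
theorem hasLineDerivAt_evalAt (R : MvPolynomial (Fin m) ℂ) (x v : EuclideanSpace ℝ (Fin m)) :
    HasLineDerivAt ℝ (evalAt R) (evalAt (dirDeriv v R) x) x v := by
  unfold HasLineDerivAt
  induction R using MvPolynomial.induction_on with
  | C a =>
    simp only [evalAt_C, dirDeriv_apply, MvPolynomial.pderiv_C, smul_zero, Finset.sum_const_zero,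
      evalAt_zero]
    exact hasDerivAt_const _ _
  | add p q hp hq => simpa only [evalAt_add, map_add] using hp.fun_add hq
  | mul_X p j hp =>
    have hX : HasDerivAt (fun t : ℝ => (((x + t • v) j : ℝ) : ℂ)) (v j : ℂ) 0 := by
      have : HasDerivAt (fun t : ℝ => x j + t * v j) (v j) 0 := by
        simpa using ((hasDerivAt_id (0 : ℝ)).mul_const (v j)).const_add (x j)
      simpa using this.ofReal_comp
    have h := hp.mul hX
    simp only [evalAt_mul, evalAt_X]
    refine h.congr_deriv ?_
    simp only [dirDeriv_apply, Derivation.leibniz, MvPolynomial.pderiv_X, evalAt_sum, evalAt_smul,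
      evalAt_add, smul_eq_mul, evalAt_mul, evalAt_X, zero_smul, add_zero, mul_add,
      Finset.sum_add_distrib]
    rw [add_comm]
    congr 1
    · rw [Finset.sum_eq_single j]
      · rw [Pi.single_eq_same]
        simp [evalAt]
        ring
      · intro i _ hi
        rw [Pi.single_eq_of_ne hi.symm]
        simp
      · simp
    · rw [Finset.sum_mul]
      refine Finset.sum_congr rfl fun i _ => ?_
      ring

/-- Substitution of the affine map `y ↦ v + L y` into a polynomial. -/
noncomputable def affineSubst (v : EuclideanSpace ℝ (Fin m))
    (L : EuclideanSpace ℝ (Fin n) →ₗᵢ[ℝ] EuclideanSpace ℝ (Fin m)) :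
    MvPolynomial (Fin m) ℂ →ₐ[ℂ] MvPolynomial (Fin n) ℂ :=
  MvPolynomial.aeval fun j => MvPolynomial.C (v j : ℂ) +
    ∑ i, ((L (EuclideanSpace.single i 1) j : ℝ) : ℂ) • MvPolynomial.X i

theorem evalAt_affineSubst (v : EuclideanSpace ℝ (Fin m))
    (L : EuclideanSpace ℝ (Fin n) →ₗᵢ[ℝ] EuclideanSpace ℝ (Fin m)) (R : MvPolynomial (Fin m) ℂ)
    (y : EuclideanSpace ℝ (Fin n)) : evalAt (affineSubst v L R) y = evalAt R (v + L y) := by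
  induction R using MvPolynomial.induction_on with
  | C a => simp [affineSubst, MvPolynomial.algebraMap_eq]
  | add p q hp hq => simp [hp, hq]
  | mul_X p j hp =>
    rw [map_mul, evalAt_mul, hp, evalAt_mul]
    congr 1
    simp only [affineSubst, MvPolynomial.aeval_X, evalAt_add, evalAt_C, evalAt_sum, evalAt_smul,
      evalAt_X, PiLp.add_apply, Complex.ofReal_add]
    congr 1
    have hy : y = ∑ i, y i • EuclideanSpace.single i (1 : ℝ) := by
      have := (EuclideanSpace.basisFun (Fin n) ℝ).sum_repr y
      simpa using this.symm
    conv_rhs => rw [hy, map_sum]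
    simp [mul_comm]

theorem pderiv_affineSubst (v : EuclideanSpace ℝ (Fin m))
    (L : EuclideanSpace ℝ (Fin n) →ₗᵢ[ℝ] EuclideanSpace ℝ (Fin m)) (R : MvPolynomial (Fin m) ℂ)
    (i : Fin n) : MvPolynomial.pderiv i (affineSubst v L R) =
      affineSubst v L (dirDeriv (L (EuclideanSpace.single i 1)) R) := by
  induction R using MvPolynomial.induction_on with
  | C a => simp [affineSubst, dirDeriv_apply, MvPolynomial.algebraMap_eq]
  | add p q hp hq => simp [hp, hq]
  | mul_X p j hp =>
    have h1 : MvPolynomial.pderiv i (affineSubst v L (MvPolynomial.X j)) =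
        MvPolynomial.C ((L (EuclideanSpace.single i 1) j : ℝ) : ℂ) := by
      simp only [affineSubst, MvPolynomial.aeval_X, map_add, MvPolynomial.pderiv_C, zero_add,
        map_sum, Derivation.map_smul, MvPolynomial.pderiv_X]
      rw [Finset.sum_eq_single i]
      · simp [MvPolynomial.smul_eq_C_mul]
      · intro k _ hk
        rw [Pi.single_eq_of_ne hk]
        simp
      · simp
    have h2 : dirDeriv (L (EuclideanSpace.single i 1)) (p * MvPolynomial.X j) =
        p * MvPolynomial.C ((L (EuclideanSpace.single i 1) j : ℝ) : ℂ) +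
          MvPolynomial.X j * dirDeriv (L (EuclideanSpace.single i 1)) p := by
      simp only [dirDeriv_apply, Derivation.leibniz, MvPolynomial.pderiv_X, smul_add,
        Finset.sum_add_distrib, smul_eq_mul, Finset.mul_sum]
      congr 1
      · rw [Finset.sum_eq_single j]
        · simp [MvPolynomial.smul_eq_C_mul, mul_comm]
        · intro k _ hk
          rw [Pi.single_eq_of_ne hk.symm]
          simp
        · simp
      · simp
    rw [map_mul, Derivation.leibniz, h1, hp, h2, map_add, map_mul, map_mul]
    simp [affineSubst, MvPolynomial.algebraMap_eq]

/-- The Laplacian is the sum of squared derivatives along any orthonormal basis; the hypothesis is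
the completeness relation of such a basis. -/
theorem sum_dirDeriv_sq {ι : Type*} [Fintype ι] (b : ι → EuclideanSpace ℝ (Fin m))
    (hb : ∀ j l, ∑ i, b i j * b i l = if j = l then 1 else 0) (R : MvPolynomial (Fin m) ℂ) :
    ∑ i, dirDeriv (b i) (dirDeriv (b i) R) = laplacian m R := by
  have hb' : ∀ j l, ∑ i, (b i j : ℂ) * (b i l : ℂ) = if j = l then 1 else 0 := by
    intro j l
    have := congrArg (fun t : ℝ => (t : ℂ)) (hb j l)
    simp only [Complex.ofReal_sum, Complex.ofReal_mul] at this
    rw [this]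
    split_ifs <;> simp
  calc ∑ i, dirDeriv (b i) (dirDeriv (b i) R)
      = ∑ i, ∑ j, ∑ l, ((b i j : ℂ) * (b i l : ℂ)) •
          MvPolynomial.pderiv j (MvPolynomial.pderiv l R) := by
        refine Finset.sum_congr rfl fun i _ => ?_
        simp only [dirDeriv_apply, map_sum, Derivation.map_smul, smul_smul]
        rw [Finset.sum_comm]
    _ = ∑ j, ∑ l, (∑ i, (b i j : ℂ) * (b i l : ℂ)) •
          MvPolynomial.pderiv j (MvPolynomial.pderiv l R) := by
        rw [Finset.sum_comm]
        refine Finset.sum_congr rfl fun j _ => ?_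
        rw [Finset.sum_comm]
        simp only [Finset.sum_smul]
    _ = _ := by
        simp only [hb', laplacian_apply, ite_smul, one_smul, zero_smul, Finset.sum_ite_eq,
          Finset.mem_univ, if_true]

end Polynomial

/-! ### Polar coordinates -/

section Polar

variable {E F : Type*} [NormedAddCommGroup E] [NormedSpace ℝ E] [MeasurableSpace E]
  [BorelSpace E] [FiniteDimensional ℝ E] [Nontrivial E] [NormedAddCommGroup F] [NormedSpace ℝ F]
  (μ : Measure E) [μ.IsAddHaarMeasure]

theorem integral_volumeIoiPow (n : ℕ) (f : ℝ → F) :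
    ∫ r : Set.Ioi (0 : ℝ), f r ∂Measure.volumeIoiPow n = ∫ r in Set.Ioi (0 : ℝ), r ^ n • f r := by
  simp only [Measure.volumeIoiPow, ENNReal.ofReal]
  rw [integral_withDensity_eq_integral_smul (measurable_subtype_coe.pow_const _).real_toNNReal,
    integral_subtype_comap measurableSet_Ioi fun a ↦ Real.toNNReal (a ^ n) • f a]
  refine setIntegral_congr_fun measurableSet_Ioi fun x hx ↦ ?_
  simp only [NNReal.smul_def, Real.coe_toNNReal _ (pow_nonneg (Set.mem_Ioi.1 hx).le _)]

theorem integral_eq_integral_toSphere_prod (f : E → F) :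
    ∫ x, f x ∂μ = ∫ q, f ((q.2 : ℝ) • (q.1 : E))
      ∂(μ.toSphere.prod (Measure.volumeIoiPow (Module.finrank ℝ E - 1))) := by
  rw [← μ.measurePreserving_homeomorphUnitSphereProd.integral_comp
    (Homeomorph.measurableEmbedding _)]
  have h : ∀ x, ((homeomorphUnitSphereProd E x).2 : ℝ) • ((homeomorphUnitSphereProd E x).1 : E)
      = x := fun x => by
    rw [← homeomorphUnitSphereProd_symm_apply_coe, Homeomorph.symm_apply_apply]
  simp only [h]
  rw [integral_subtype_comap (measurableSet_singleton _).compl f, restrict_compl_singleton]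

/-- Integration in polar coordinates. -/
theorem integral_eq_integral_polar {f : E → F} (hf : Integrable f μ) :
    ∫ x, f x ∂μ = ∫ r in Set.Ioi (0 : ℝ),
      r ^ (Module.finrank ℝ E - 1) • ∫ η, f (r • (η : E)) ∂μ.toSphere := by
  rw [integral_eq_integral_toSphere_prod, integral_prod_symm,
    integral_volumeIoiPow _ fun r => ∫ η, f (r • (η : E)) ∂μ.toSphere]
  rw [← μ.measurePreserving_homeomorphUnitSphereProd.integrable_comp_emb
    (Homeomorph.measurableEmbedding _)]
  have h : ∀ x, ((homeomorphUnitSphereProd E x).2 : ℝ) • ((homeomorphUnitSphereProd E x).1 : E)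
      = x := fun x => by
    rw [← homeomorphUnitSphereProd_symm_apply_coe, Homeomorph.symm_apply_apply]
  simp only [Function.comp_def, h]
  have := (integrableOn_iff_comap_subtypeVal (μ := μ) (f := f)
    (measurableSet_singleton (0 : E)).compl).1 hf.integrableOn
  exact this

/-- Integration in polar coordinates of a product of an angular and a radial factor. -/
theorem integral_polar_mul {f : E → ℂ} (g : Metric.sphere (0 : E) 1 → ℂ) (h : ℝ → ℂ)
    (hf : ∀ (η : Metric.sphere (0 : E) 1) (r : ℝ), 0 < r → f (r • (η : E)) = g η * h r) :
    ∫ x, f x ∂μ = (∫ η, g η ∂μ.toSphere) *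
      ∫ r in Set.Ioi (0 : ℝ), (r : ℂ) ^ (Module.finrank ℝ E - 1) * h r := by
  rw [integral_eq_integral_toSphere_prod]
  have : ∀ q : Metric.sphere (0 : E) 1 × Set.Ioi (0 : ℝ),
      f ((q.2 : ℝ) • (q.1 : E)) = g q.1 * h q.2 := fun q => hf q.1 q.2 q.2.2
  simp only [this]
  rw [integral_prod_mul g fun r : Set.Ioi (0 : ℝ) => h r, integral_volumeIoiPow _ h]
  simp [Complex.real_smul]

end Polar

/-! ### Gaussian moments of polynomials -/

theorem integral_Ioi_pow_mul_exp_neg_sq (a : ℕ) :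
    ∫ r in Set.Ioi (0 : ℝ), r ^ a * rexp (-r ^ 2) = Real.Gamma (((a : ℝ) + 1) / 2) / 2 := by
  have h := integral_rpow_mul_exp_neg_rpow (p := 2) (q := a) two_pos
    (by have : (0 : ℝ) ≤ a := a.cast_nonneg; linarith)
  simp only [Real.rpow_natCast, Real.rpow_two] at h
  rw [h]
  ring

theorem integrableOn_Ioi_pow_mul_exp_neg_sq (a : ℕ) :
    IntegrableOn (fun r : ℝ => r ^ a * rexp (-r ^ 2)) (Set.Ioi 0) := by
  have h := integrableOn_rpow_mul_exp_neg_rpow (p := 2) (s := a)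
    (by have : (0 : ℝ) ≤ a := a.cast_nonneg; linarith) two_pos
  simpa only [Real.rpow_natCast, Real.rpow_two] using h

theorem integral_Ioi_pow_mul_exp_neg_sq_complex (a : ℕ) :
    ∫ r in Set.Ioi (0 : ℝ), (r : ℂ) ^ a * (rexp (-r ^ 2) : ℂ) =
      ((Real.Gamma (((a : ℝ) + 1) / 2) / 2 : ℝ) : ℂ) := by
  rw [← integral_Ioi_pow_mul_exp_neg_sq, ← integral_complex_ofReal]
  simp

section Gaussian

variable {n : ℕ}

/-- Integration of a polynomial against the weight `exp (-‖x‖²)`. -/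
noncomputable def gaussIntegral (Q : MvPolynomial (Fin n) ℂ) : ℂ :=
  ∫ x : EuclideanSpace ℝ (Fin n), evalAt Q x * (rexp (-‖x‖ ^ 2) : ℂ)

theorem gaussIntegral_smul (c : ℂ) (Q : MvPolynomial (Fin n) ℂ) :
    gaussIntegral (c • Q) = c * gaussIntegral Q := by
  simp only [gaussIntegral, evalAt_smul, mul_assoc]
  exact integral_const_mul _ _

theorem gaussIntegral_C (c : ℂ) :
    gaussIntegral (MvPolynomial.C c : MvPolynomial (Fin n) ℂ) = c * ((π ^ ((n : ℝ) / 2) : ℝ) : ℂ) := by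
  have h := GaussianFourier.integral_rexp_neg_mul_sq_norm (V := EuclideanSpace ℝ (Fin n))
    (b := 1) one_pos
  simp only [neg_mul, one_mul, div_one, finrank_euclideanSpace, Fintype.card_fin] at h
  simp only [gaussIntegral, evalAt_C]
  rw [integral_const_mul, ← h, ← integral_complex_ofReal]

theorem integrable_evalAt_toSphere (Q : MvPolynomial (Fin n) ℂ) (s : ℝ) :
    Integrable (fun η : Metric.sphere (0 : EuclideanSpace ℝ (Fin n)) 1 =>
      evalAt Q (s • (η : EuclideanSpace ℝ (Fin n))))
      (volume : Measure (EuclideanSpace ℝ (Fin n))).toSphere := by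
  have hc : Continuous fun η : Metric.sphere (0 : EuclideanSpace ℝ (Fin n)) 1 =>
      evalAt Q (s • (η : EuclideanSpace ℝ (Fin n))) :=
    (continuous_evalAt Q).comp (by fun_prop)
  have := hc.continuousOn.integrableOn_compact (μ := (volume : Measure
    (EuclideanSpace ℝ (Fin n))).toSphere) isCompact_univ
  rwa [integrableOn_univ] at this

variable [NeZero n]

theorem integrable_evalAt_mul_exp (Q : MvPolynomial (Fin n) ℂ) :
    Integrable fun x : EuclideanSpace ℝ (Fin n) => evalAt Q x * (rexp (-‖x‖ ^ 2) : ℂ) := by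
  induction Q using MvPolynomial.induction_on' with
  | monomial u a =>
    have hint : Integrable fun x : EuclideanSpace ℝ (Fin n) =>
        ‖a‖ * (‖x‖ ^ u.degree * rexp (-‖x‖ ^ 2)) := by
      refine Integrable.const_mul ?_ _
      rw [integrable_fun_norm_addHaar volume (f := fun r => r ^ u.degree * rexp (-r ^ 2))]
      have := integrableOn_Ioi_pow_mul_exp_neg_sq
        (Module.finrank ℝ (EuclideanSpace ℝ (Fin n)) - 1 + u.degree)
      simpa only [smul_eq_mul, pow_add, mul_assoc] using this
    refine hint.mono' ?_ (.of_forall fun x => ?_)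
    · refine Continuous.aestronglyMeasurable ?_
      exact (continuous_evalAt _).mul (by fun_prop)
    · rw [norm_mul, ← mul_assoc, Complex.norm_real, Real.norm_of_nonneg (Real.exp_pos _).le]
      gcongr
      exact norm_evalAt_monomial_le u a x
  | add p q hp hq => simpa only [evalAt_add, add_mul] using hp.fun_add hq

theorem gaussIntegral_sum {ι : Type*} (s : Finset ι) (Q : ι → MvPolynomial (Fin n) ℂ) :
    gaussIntegral (∑ i ∈ s, Q i) = ∑ i ∈ s, gaussIntegral (Q i) := by
  simp only [gaussIntegral, evalAt_sum, Finset.sum_mul]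
  exact integral_finsetSum _ fun i _ => integrable_evalAt_mul_exp (Q i)

/-- Gaussian integration by parts. -/
theorem gaussIntegral_pderiv (Q : MvPolynomial (Fin n) ℂ) (j : Fin n) :
    gaussIntegral (MvPolynomial.pderiv j Q) = 2 * gaussIntegral (MvPolynomial.X j * Q) := by
  have hd : dirDeriv (EuclideanSpace.single j (1 : ℝ)) Q = MvPolynomial.pderiv j Q := by
    rw [dirDeriv_apply, Finset.sum_eq_single j]
    · simp
    · intro i _ hi
      simp [hi]
    · simp
  have hg : ∀ x : EuclideanSpace ℝ (Fin n), HasLineDerivAt ℝ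
      (fun x : EuclideanSpace ℝ (Fin n) => (rexp (-‖x‖ ^ 2) : ℂ))
      (-2 * (x j : ℂ) * (rexp (-‖x‖ ^ 2) : ℂ)) x (EuclideanSpace.single j (1 : ℝ)) := by
    intro x
    unfold HasLineDerivAt
    have h1 : HasDerivAt (fun t : ℝ => x + t • EuclideanSpace.single j (1 : ℝ))
        (EuclideanSpace.single j (1 : ℝ)) 0 := by
      simpa using ((hasDerivAt_id (0 : ℝ)).smul_const
        (EuclideanSpace.single j (1 : ℝ))).const_add x
    have h2 := (h1.norm_sq.fun_neg.exp).ofReal_comp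
    refine h2.congr_deriv ?_
    simp [EuclideanSpace.inner_single_right]
    ring
  have h := integral_bilinear_hasLineDerivAt_right_eq_neg_left_of_integrable
    (μ := (volume : Measure (EuclideanSpace ℝ (Fin n))))
    (f := evalAt Q) (f' := evalAt (MvPolynomial.pderiv j Q))
    (g := fun x => (rexp (-‖x‖ ^ 2) : ℂ)) (g' := fun x => -2 * (x j : ℂ) * (rexp (-‖x‖ ^ 2) : ℂ))
    (v := EuclideanSpace.single j (1 : ℝ)) (B := ContinuousLinearMap.mul ℝ ℂ)
    (integrable_evalAt_mul_exp _) ?_ (integrable_evalAt_mul_exp _)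
    (fun x _ => by rw [← hd]; exact hasLineDerivAt_evalAt Q x _) (fun x _ => hg x)
  · simp only [ContinuousLinearMap.mul_apply'] at h
    have e : ∀ x : EuclideanSpace ℝ (Fin n),
        evalAt Q x * (-2 * (x j : ℂ) * (rexp (-‖x‖ ^ 2) : ℂ)) =
          -2 * (evalAt (MvPolynomial.X j * Q) x * (rexp (-‖x‖ ^ 2) : ℂ)) := fun x => by
      rw [evalAt_mul, evalAt_X]; ring
    simp only [e] at h
    rw [integral_const_mul] at h
    simp only [gaussIntegral]
    linear_combination h
  · have := (integrable_evalAt_mul_exp (MvPolynomial.X j * Q)).const_mul (-2)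
    refine this.congr (.of_forall fun x => ?_)
    simp only [evalAt_mul, evalAt_X, ContinuousLinearMap.mul_apply']
    ring

/-- On homogeneous polynomials the Laplacian acts on Gaussian integrals as a scalar: integrate by
parts once and use Euler's identity. -/
theorem gaussIntegral_laplacian {ℓ : ℕ} {Q : MvPolynomial (Fin n) ℂ} (hQ : Q.IsHomogeneous ℓ) :
    gaussIntegral (laplacian n Q) = 2 * ℓ * gaussIntegral Q := by
  rw [laplacian_apply, gaussIntegral_sum]
  simp only [gaussIntegral_pderiv]
  rw [← Finset.mul_sum, ← gaussIntegral_sum, hQ.sum_X_mul_pderiv, ← Nat.cast_smul_eq_nsmul ℂ,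
    gaussIntegral_smul]
  ring

theorem gaussIntegral_of_even {k : ℕ} {Q : MvPolynomial (Fin n) ℂ} (hQ : Q.IsHomogeneous (2 * k)) :
    2 ^ (2 * k) * (k ! : ℂ) * gaussIntegral Q =
      ((π ^ ((n : ℝ) / 2) : ℝ) : ℂ) * evalAt ((laplacian n ^ k) Q) 0 := by
  induction k generalizing Q with
  | zero =>
    rw [MvPolynomial.totalDegree_eq_zero_iff_eq_C.1
      ((MvPolynomial.totalDegree_zero_iff_isHomogeneous _).2 hQ), gaussIntegral_C]
    simp [mul_comm]
  | succ k ih =>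
    have h := ih (Q := laplacian n Q) (isHomogeneous_laplacian hQ)
    rw [gaussIntegral_laplacian hQ] at h
    rw [pow_succ (laplacian n), Module.End.mul_apply, ← h, Nat.factorial_succ]
    push_cast
    ring

theorem gaussIntegral_of_odd {k : ℕ} {Q : MvPolynomial (Fin n) ℂ}
    (hQ : Q.IsHomogeneous (2 * k + 1)) : gaussIntegral Q = 0 := by
  induction k generalizing Q with
  | zero =>
    have h := gaussIntegral_laplacian hQ
    have h0 : laplacian n Q = 0 := by
      simpa using laplacian_pow_eq_zero hQ (k := 1) (by norm_num)
    rw [h0] at h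
    have h1 : gaussIntegral (0 : MvPolynomial (Fin n) ℂ) = 0 := by simp [gaussIntegral]
    rw [h1] at h
    simpa using h.symm
  | succ k ih =>
    have h := gaussIntegral_laplacian hQ
    rw [ih (Q := laplacian n Q) (isHomogeneous_laplacian hQ)] at h
    have h2 : (2 * ((2 * (k + 1) + 1 : ℕ) : ℂ)) ≠ 0 :=
      mul_ne_zero two_ne_zero (Nat.cast_ne_zero.2 (Nat.succ_ne_zero _))
    exact (mul_eq_zero.1 h.symm).resolve_left h2

/-! ### Pizzetti's formula on spheres centred at the origin -/

/-- Gaussian integrals of homogeneous polynomials, in polar coordinates. -/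
theorem gaussIntegral_eq_toSphere {ℓ : ℕ} {Q : MvPolynomial (Fin n) ℂ} (hQ : Q.IsHomogeneous ℓ) :
    gaussIntegral Q =
      (∫ η, evalAt Q (η : EuclideanSpace ℝ (Fin n))
        ∂(volume : Measure (EuclideanSpace ℝ (Fin n))).toSphere) *
      ((Real.Gamma (((n : ℝ) + ℓ) / 2) / 2 : ℝ) : ℂ) := by
  have h := integral_polar_mul (volume : Measure (EuclideanSpace ℝ (Fin n)))
    (f := fun x => evalAt Q x * (rexp (-‖x‖ ^ 2) : ℂ)) (fun η => evalAt Q η)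
    (fun r => (r : ℂ) ^ ℓ * (rexp (-r ^ 2) : ℂ)) (fun η r hr => by
      rw [evalAt_smul_of_isHomogeneous hQ, norm_smul, norm_eq_of_mem_sphere, mul_one,
        Real.norm_of_nonneg hr.le]
      ring)
  rw [gaussIntegral, h]
  congr 1
  simp only [← mul_assoc, ← pow_add]
  rw [integral_Ioi_pow_mul_exp_neg_sq_complex, finrank_euclideanSpace, Fintype.card_fin]
  have hn : 1 ≤ n := NeZero.one_le
  congr 4
  push_cast [Nat.cast_sub hn]
  ring

/-- The coefficients `2 π^(n/2) / (4^k k! Γ(n/2+k))` of Pizzetti's formula. -/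
noncomputable def pizzettiCoeff (n k : ℕ) : ℝ :=
  2 * π ^ ((n : ℝ) / 2) / (2 ^ (2 * k) * (k ! : ℝ) * Real.Gamma ((n : ℝ) / 2 + k))

theorem integral_toSphere_of_even {k : ℕ} {Q : MvPolynomial (Fin n) ℂ}
    (hQ : Q.IsHomogeneous (2 * k)) :
    ∫ η, evalAt Q (η : EuclideanSpace ℝ (Fin n))
        ∂(volume : Measure (EuclideanSpace ℝ (Fin n))).toSphere =
      (pizzettiCoeff n k : ℂ) * evalAt ((laplacian n ^ k) Q) 0 := by
  have h1 := gaussIntegral_of_even hQ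
  rw [gaussIntegral_eq_toSphere hQ] at h1
  have hn : (0 : ℝ) < n := by exact_mod_cast NeZero.pos n
  have hG : Real.Gamma ((n : ℝ) / 2 + k) ≠ 0 := (Real.Gamma_pos_of_pos (by positivity)).ne'
  have e : ((n : ℝ) + (2 * k : ℕ)) / 2 = (n : ℝ) / 2 + k := by push_cast; ring
  rw [e] at h1
  have hG' : (Real.Gamma ((n : ℝ) / 2 + k) : ℂ) ≠ 0 := by exact_mod_cast hG
  have hk : (k ! : ℂ) ≠ 0 := by exact_mod_cast k.factorial_ne_zero
  rw [pizzettiCoeff]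
  push_cast at h1 ⊢
  generalize (Real.Gamma ((n : ℝ) / 2 + k) : ℂ) = G at h1 hG'
  field_simp
  linear_combination 2 * h1

theorem integral_toSphere_of_odd {k : ℕ} {Q : MvPolynomial (Fin n) ℂ}
    (hQ : Q.IsHomogeneous (2 * k + 1)) :
    ∫ η, evalAt Q (η : EuclideanSpace ℝ (Fin n))
        ∂(volume : Measure (EuclideanSpace ℝ (Fin n))).toSphere = 0 := by
  have h1 := gaussIntegral_eq_toSphere hQ
  rw [gaussIntegral_of_odd hQ] at h1
  have hn : (0 : ℝ) < n := by exact_mod_cast NeZero.pos n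
  refine (mul_eq_zero.1 h1.symm).resolve_right ?_
  have := (Real.Gamma_pos_of_pos (show 0 < ((n : ℝ) + (2 * k + 1 : ℕ)) / 2 by positivity)).ne'
  simpa using this

/-- Pizzetti's formula for the sphere of radius `s` in `ℝⁿ`, in angular coordinates. -/
theorem hasSum_integral_toSphere (Q : MvPolynomial (Fin n) ℂ) (s : ℝ) :
    HasSum (fun k : ℕ => (pizzettiCoeff n k : ℂ) * evalAt ((laplacian n ^ k) Q) 0 *
        (s : ℂ) ^ (2 * k))
      (∫ η, evalAt Q (s • (η : EuclideanSpace ℝ (Fin n)))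
        ∂(volume : Measure (EuclideanSpace ℝ (Fin n))).toSphere) := by
  induction Q using MvPolynomial.induction_on' with
  | monomial u a =>
    set Q := MvPolynomial.monomial u a
    have hQ : Q.IsHomogeneous u.degree := MvPolynomial.isHomogeneous_monomial a rfl
    simp only [evalAt_smul_of_isHomogeneous hQ]
    rw [integral_const_mul]
    rcases Nat.even_or_odd' u.degree with ⟨k, hk | hk⟩
    · rw [hk] at hQ ⊢
      rw [integral_toSphere_of_even hQ, mul_comm]
      refine hasSum_single k fun j hj => ?_
      rw [evalAt_zero_laplacian_pow hQ (by omega)]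
      ring
    · rw [hk] at hQ ⊢
      rw [integral_toSphere_of_odd hQ, mul_zero]
      have : ∀ j, evalAt ((laplacian n ^ j) Q) 0 = 0 := fun j =>
        evalAt_zero_laplacian_pow hQ (by omega)
      simp only [this, mul_zero, zero_mul]
      exact hasSum_zero
  | add p q hp hq =>
    simp only [map_add, evalAt_add, mul_add, add_mul]
    rw [integral_add (integrable_evalAt_toSphere p s) (integrable_evalAt_toSphere q s)]
    exact hp.add hq

end Gaussian

/-! ### Orthonormal coordinates adapted to a hyperplane -/

section Hyperplane

variable {n : ℕ} {ω : EuclideanSpace ℝ (Fin (n + 1))}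

/-- A linear isometry of `ℝⁿ` onto the orthogonal complement of `ω` in `ℝⁿ⁺¹`. -/
noncomputable def orthIsometry (hω : ‖ω‖ = 1) :
    EuclideanSpace ℝ (Fin n) →ₗᵢ[ℝ] EuclideanSpace ℝ (Fin (n + 1)) :=
  haveI : Fact (Module.finrank ℝ (EuclideanSpace ℝ (Fin (n + 1))) = n + 1) := ⟨by simp⟩
  (ℝ ∙ ω)ᗮ.subtypeₗᵢ.comp (OrthonormalBasis.fromOrthogonalSpanSingleton (𝕜 := ℝ) n
    (show ω ≠ 0 by rintro rfl; simp at hω)).repr.symm.toLinearIsometry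

theorem inner_orthIsometry (hω : ‖ω‖ = 1) (y : EuclideanSpace ℝ (Fin n)) :
    inner ℝ ω (orthIsometry hω y) = 0 :=
  Submodule.mem_orthogonal_singleton_iff_inner_right.1 (Subtype.coe_prop _)

theorem exists_orthIsometry_eq (hω : ‖ω‖ = 1) {x : EuclideanSpace ℝ (Fin (n + 1))}
    (hx : inner ℝ ω x = 0) : ∃ y, orthIsometry hω y = x := by
  have : Fact (Module.finrank ℝ (EuclideanSpace ℝ (Fin (n + 1))) = n + 1) := ⟨by simp⟩
  refine ⟨(OrthonormalBasis.fromOrthogonalSpanSingleton (𝕜 := ℝ) n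
    (show ω ≠ 0 by rintro rfl; simp at hω)).repr
      ⟨x, Submodule.mem_orthogonal_singleton_iff_inner_right.2 hx⟩, ?_⟩
  simp [orthIsometry]

theorem exists_eq_add_orthIsometry (hω : ‖ω‖ = 1) (x : EuclideanSpace ℝ (Fin (n + 1))) :
    ∃ y, x = inner ℝ ω x • ω + orthIsometry hω y := by
  obtain ⟨y, hy⟩ := exists_orthIsometry_eq hω (x := x - inner ℝ ω x • ω) (by
    simp [inner_sub_right, inner_smul_right, hω])
  exact ⟨y, by rw [hy]; abel⟩

theorem inner_smul_add_orthIsometry (hω : ‖ω‖ = 1) (s t : ℝ) (y z : EuclideanSpace ℝ (Fin n)) :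
    inner ℝ (s • ω + orthIsometry hω y) (t • ω + orthIsometry hω z) = s * t + inner ℝ y z := by
  have h := inner_orthIsometry hω y
  rw [real_inner_comm] at h
  simp only [inner_add_left, inner_add_right, inner_smul_left, inner_smul_right, h,
    inner_orthIsometry, LinearIsometry.inner_map_map, real_inner_self_eq_norm_sq, hω]
  simp [mul_comm]

theorem norm_sq_smul_add_orthIsometry (hω : ‖ω‖ = 1) (s : ℝ) (y : EuclideanSpace ℝ (Fin n)) :
    ‖s • ω + orthIsometry hω y‖ ^ 2 = s ^ 2 + ‖y‖ ^ 2 := by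
  rw [← real_inner_self_eq_norm_sq, inner_smul_add_orthIsometry, real_inner_self_eq_norm_sq, sq s]

theorem inner_smul_add_orthIsometry_left (hω : ‖ω‖ = 1) (s : ℝ) (y : EuclideanSpace ℝ (Fin n)) :
    inner ℝ (s • ω + orthIsometry hω y) ω = s := by
  have h := inner_smul_add_orthIsometry hω s 1 y 0
  simpa using h

/-- The completeness relation for the orthonormal basis `ω, L e₁, …, L eₙ`. -/
theorem sum_orthIsometry_mul (hω : ‖ω‖ = 1) (j l : Fin (n + 1)) :
    ∑ i, orthIsometry hω (EuclideanSpace.single i 1) j *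
      orthIsometry hω (EuclideanSpace.single i 1) l = (if j = l then 1 else 0) - ω j * ω l := by
  have key : ∀ j : Fin (n + 1), ∃ y : EuclideanSpace ℝ (Fin n),
      EuclideanSpace.single j (1 : ℝ) = ω j • ω + orthIsometry hω y ∧
        ∀ i, y i = orthIsometry hω (EuclideanSpace.single i 1) j := by
    intro j
    obtain ⟨y, hy⟩ := exists_eq_add_orthIsometry hω (EuclideanSpace.single j (1 : ℝ))
    rw [EuclideanSpace.inner_single_right] at hy
    simp only [conj_trivial, one_mul] at hy
    refine ⟨y, hy, fun i => ?_⟩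
    have h1 : inner ℝ (orthIsometry hω (EuclideanSpace.single i 1))
        (EuclideanSpace.single j (1 : ℝ)) = y i := by
      have h2 := inner_smul_add_orthIsometry hω 0 (ω j) (EuclideanSpace.single i 1) y
      rw [← hy, zero_smul, zero_add] at h2
      rw [h2, EuclideanSpace.inner_single_left]
      simp
    rw [← h1, EuclideanSpace.inner_single_right]
    simp
  obtain ⟨y, hy, hy'⟩ := key j
  obtain ⟨z, hz, hz'⟩ := key l
  have h := inner_smul_add_orthIsometry hω (ω j) (ω l) y z
  rw [← hy, ← hz, EuclideanSpace.inner_single_left, PiLp.inner_apply] at h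
  simp only [← hy', ← hz']
  have h3 : (EuclideanSpace.single l (1 : ℝ) : EuclideanSpace ℝ (Fin (n + 1))) j =
      if j = l then 1 else 0 := by simp
  rw [h3] at h
  simp only [conj_trivial, one_mul, RCLike.inner_apply] at h
  rw [h]
  simp [mul_comm]

/-- In coordinates of the hyperplane, `Δ - ⟨ω, ∂⟩²` is the Laplacian. -/
theorem laplacian_affineSubst (hω : ‖ω‖ = 1) (v : EuclideanSpace ℝ (Fin (n + 1)))
    (R : MvPolynomial (Fin (n + 1)) ℂ) :
    laplacian n (affineSubst v (orthIsometry hω) R) =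
      affineSubst v (orthIsometry hω) (pizzettiOp ω R) := by
  have h := sum_dirDeriv_sq (ι := Option (Fin n))
    (fun o => o.elim ω fun i => orthIsometry hω (EuclideanSpace.single i 1)) (fun j l => by
      rw [Fintype.sum_option]
      simp only [Option.elim_none, Option.elim_some, sum_orthIsometry_mul]
      ring) R
  rw [Fintype.sum_option] at h
  simp only [Option.elim_none, Option.elim_some] at h
  rw [pizzettiOp_apply, ← h, add_sub_cancel_left, map_sum, laplacian_apply]
  simp only [pderiv_affineSubst]

theorem evalAt_laplacian_pow_affineSubst (hω : ‖ω‖ = 1) (v : EuclideanSpace ℝ (Fin (n + 1)))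
    (R : MvPolynomial (Fin (n + 1)) ℂ) (k : ℕ) :
    evalAt ((laplacian n ^ k) (affineSubst v (orthIsometry hω) R)) 0 =
      evalAt ((pizzettiOp ω ^ k) R) v := by
  have : (laplacian n ^ k) (affineSubst v (orthIsometry hω) R) =
      affineSubst v (orthIsometry hω) ((pizzettiOp ω ^ k) R) := by
    induction k with
    | zero => simp
    | succ k ih =>
      rw [pow_succ', Module.End.mul_apply, ih, laplacian_affineSubst, pow_succ',
        Module.End.mul_apply]
  rw [this, evalAt_affineSubst, map_zero, add_zero]

theorem isometry_add_orthIsometry (hω : ‖ω‖ = 1) (v : EuclideanSpace ℝ (Fin (n + 1))) :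
    Isometry fun y => v + orthIsometry hω y :=
  (isometry_add_left v).comp (orthIsometry hω).isometry

/-- Lebesgue measure is the product measure in the coordinates `s • ω + L y`. -/
theorem measurePreserving_smul_add_orthIsometry (hω : ‖ω‖ = 1) :
    MeasurePreserving (fun q : ℝ × EuclideanSpace ℝ (Fin n) => q.1 • ω + orthIsometry hω q.2) := by
  let T : WithLp 2 (ℝ × EuclideanSpace ℝ (Fin n)) →ₗᵢ[ℝ] EuclideanSpace ℝ (Fin (n + 1)) :=
    { toFun := fun q => q.fst • ω + orthIsometry hω q.snd
      map_add' := fun q r => by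
        simp only [WithLp.add_fst, WithLp.add_snd, add_smul, map_add]; abel
      map_smul' := fun c q => by
        simp only [WithLp.smul_fst, WithLp.smul_snd, smul_eq_mul, mul_smul, map_smul, smul_add,
          RingHom.id_apply]
      norm_map' := fun q => by
        rw [← sq_eq_sq₀ (norm_nonneg _) (norm_nonneg _)]
        refine (norm_sq_smul_add_orthIsometry hω q.fst q.snd).trans ?_
        rw [WithLp.prod_norm_sq_eq_of_L2, Real.norm_eq_abs, sq_abs] }
  have hfin : Module.finrank ℝ (WithLp 2 (ℝ × EuclideanSpace ℝ (Fin n))) =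
      Module.finrank ℝ (EuclideanSpace ℝ (Fin (n + 1))) := by
    rw [(WithLp.linearEquiv 2 ℝ (ℝ × EuclideanSpace ℝ (Fin n))).finrank_eq]
    simp [add_comm]
  exact ((T.toLinearIsometryEquiv hfin).measurePreserving).comp
    (WithLp.volume_preserving_toLp ℝ (EuclideanSpace ℝ (Fin n)))

/-! ### Sub-spheres and sub-balls -/

variable {p : ℝ}

theorem one_sub_sq_pos (hp0 : 0 ≤ p) (hp1 : p < 1) : 0 < 1 - p ^ 2 := by nlinarith

theorem sqrt_pow_eq_rpow {a : ℝ} (ha : 0 ≤ a) (j : ℕ) : √a ^ j = a ^ ((j : ℝ) / 2) := by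
  rw [Real.sqrt_eq_rpow, ← Real.rpow_natCast, ← Real.rpow_mul ha]
  congr 1
  ring

theorem add_orthIsometry_mem_subSphere_iff (hω : ‖ω‖ = 1) (hp0 : 0 ≤ p) (hp1 : p < 1)
    (y : EuclideanSpace ℝ (Fin n)) :
    p • ω + orthIsometry hω y ∈ subSphere ω p ↔ ‖y‖ = √(1 - p ^ 2) := by
  have h := norm_sq_smul_add_orthIsometry hω p y
  rw [subSphere, hyperplane, Set.mem_inter_iff, Set.mem_ofPred_eq, mem_sphere_zero_iff_norm,
    inner_smul_add_orthIsometry_left, and_iff_left rfl, ← sq_eq_sq₀ (norm_nonneg _) zero_le_one, h,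
    ← sq_eq_sq₀ (norm_nonneg y) (Real.sqrt_nonneg _), Real.sq_sqrt (one_sub_sq_pos hp0 hp1).le]
  constructor <;> intro h <;> linarith

theorem add_orthIsometry_mem_subBall_iff (hω : ‖ω‖ = 1) (hp0 : 0 ≤ p) (hp1 : p < 1)
    (y : EuclideanSpace ℝ (Fin n)) :
    p • ω + orthIsometry hω y ∈ subBall ω p ↔ ‖y‖ < √(1 - p ^ 2) := by
  have h := norm_sq_smul_add_orthIsometry hω p y
  rw [subBall, hyperplane, Set.mem_inter_iff, Set.mem_ofPred_eq, mem_ball_zero_iff,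
    inner_smul_add_orthIsometry_left, and_iff_left rfl, ← sq_lt_sq₀ (norm_nonneg _) zero_le_one, h,
    ← sq_lt_sq₀ (norm_nonneg y) (Real.sqrt_nonneg _), Real.sq_sqrt (one_sub_sq_pos hp0 hp1).le]
  constructor <;> intro h <;> linarith

theorem exists_of_mem_hyperplane (hω : ‖ω‖ = 1) {x : EuclideanSpace ℝ (Fin (n + 1))}
    (hx : x ∈ hyperplane ω p) : ∃ y, x = p • ω + orthIsometry hω y := by
  obtain ⟨y, hy⟩ := exists_eq_add_orthIsometry hω x
  have : inner ℝ ω x = p := by rw [real_inner_comm]; exact hx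
  exact ⟨y, by rwa [this] at hy⟩

theorem integrableOn_ball (Q : MvPolynomial (Fin n) ℂ) (s : ℝ) :
    IntegrableOn (evalAt Q) (Metric.ball 0 s) :=
  ((continuous_evalAt Q).continuousOn.integrableOn_compact
    (isCompact_closedBall (0 : EuclideanSpace ℝ (Fin n)) s)).mono_set Metric.ball_subset_closedBall

theorem restrict_subBall (hω : ‖ω‖ = 1) (hp0 : 0 ≤ p) (hp1 : p < 1) :
    (μHE[n]).restrict (subBall ω p) =
      Measure.map (fun y : EuclideanSpace ℝ (Fin n) => p • ω + orthIsometry hω y)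
        (volume.restrict (Metric.ball 0 √(1 - p ^ 2))) := by
  have hi := isometry_add_orthIsometry hω (p • ω)
  have hemb : MeasurableEmbedding fun y => p • ω + orthIsometry hω y :=
    hi.isClosedEmbedding.measurableEmbedding
  have hpre : (fun y => p • ω + orthIsometry hω y) ⁻¹' subBall ω p =
      Metric.ball 0 √(1 - p ^ 2) := by
    ext y
    rw [Set.mem_preimage, add_orthIsometry_mem_subBall_iff hω hp0 hp1, mem_ball_zero_iff]
  have hsub : subBall ω p ⊆ Set.range fun y => p • ω + orthIsometry hω y := fun x hx => by
    obtain ⟨y, rfl⟩ := exists_of_mem_hyperplane hω hx.2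
    exact ⟨y, rfl⟩
  rw [← hpre, ← hemb.restrict_map, ← EuclideanSpace.euclideanHausdorffMeasure_eq_volume,
    hi.map_euclideanHausdorffMeasure, Measure.restrict_restrict_of_subset hsub]

theorem integrableOn_subBall (hω : ‖ω‖ = 1) (hp0 : 0 ≤ p) (hp1 : p < 1)
    (R : MvPolynomial (Fin (n + 1)) ℂ) : IntegrableOn (evalAt R) (subBall ω p) μHE[n] := by
  have hi := isometry_add_orthIsometry hω (p • ω)
  rw [IntegrableOn, restrict_subBall hω hp0 hp1,
    integrable_map_measure (continuous_evalAt R).aestronglyMeasurable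
      hi.continuous.measurable.aemeasurable]
  simpa only [Function.comp_def, IntegrableOn, ← evalAt_affineSubst] using
    integrableOn_ball (affineSubst (p • ω) (orthIsometry hω) R) √(1 - p ^ 2)

variable [NeZero n]

theorem euclideanHausdorffMeasure_sphere_fin :
    (μHE[n - 1] : Measure (Metric.sphere (0 : EuclideanSpace ℝ (Fin n)) 1)) =
      (volume : Measure (EuclideanSpace ℝ (Fin n))).toSphere := by
  have h := euclideanHausdorffMeasure_sphere (E := EuclideanSpace ℝ (Fin n))
  simpa using h

/-- Surface measure on the sub-sphere is the pushforward of the scaled surface measure on the unit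
sphere of `ℝⁿ`. -/
theorem restrict_subSphere (hω : ‖ω‖ = 1) (hp0 : 0 ≤ p) (hp1 : p < 1) :
    (μHE[n - 1]).restrict (subSphere ω p) = ENNReal.ofReal (√(1 - p ^ 2) ^ (n - 1)) •
      Measure.map (fun η : Metric.sphere (0 : EuclideanSpace ℝ (Fin n)) 1 =>
        p • ω + orthIsometry hω (√(1 - p ^ 2) • (η : EuclideanSpace ℝ (Fin n))))
        (volume : Measure (EuclideanSpace ℝ (Fin n))).toSphere := by
  set s := √(1 - p ^ 2) with hs
  have hs0 : 0 < s := Real.sqrt_pos.2 (one_sub_sq_pos hp0 hp1)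
  set g := fun η : Metric.sphere (0 : EuclideanSpace ℝ (Fin n)) 1 =>
    p • ω + orthIsometry hω (s • (η : EuclideanSpace ℝ (Fin n))) with hg
  have hgc : Continuous g := by fun_prop
  ext A hA
  rw [Measure.smul_apply, Measure.map_apply hgc.measurable hA, Measure.restrict_apply hA,
    ← euclideanHausdorffMeasure_sphere_fin]
  have himg : A ∩ subSphere ω p = (fun y => p • ω + orthIsometry hω y) ''
      (s • (Subtype.val '' (g ⁻¹' A))) := by
    ext x
    constructor
    · rintro ⟨hxA, hx⟩
      obtain ⟨y, rfl⟩ := exists_of_mem_hyperplane hω hx.2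
      have hy := (add_orthIsometry_mem_subSphere_iff hω hp0 hp1 y).1 hx
      rw [← hs] at hy
      have hy1 : s⁻¹ • y ∈ Metric.sphere (0 : EuclideanSpace ℝ (Fin n)) 1 := by
        rw [mem_sphere_zero_iff_norm, norm_smul, hy, Real.norm_of_nonneg (inv_pos.2 hs0).le,
          inv_mul_cancel₀ hs0.ne']
      refine ⟨y, ⟨s⁻¹ • y, ⟨⟨_, hy1⟩, ?_, rfl⟩, smul_inv_smul₀ hs0.ne' y⟩, rfl⟩
      simpa only [hg, Set.mem_preimage, smul_inv_smul₀ hs0.ne' y] using hxA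
    · rintro ⟨_, ⟨_, ⟨η, hη, rfl⟩, rfl⟩, rfl⟩
      refine ⟨hη, (add_orthIsometry_mem_subSphere_iff hω hp0 hp1 _).2 ?_⟩
      simp [norm_smul, hs]
  rw [himg, (isometry_add_orthIsometry hω (p • ω)).euclideanHausdorffMeasure_image,
    Measure.euclideanHausdorffMeasure_smul₀ _ hs0.ne',
    isometry_subtype_coe.euclideanHausdorffMeasure_image, smul_eq_mul, ENNReal.smul_def,
    smul_eq_mul, ENNReal.ofReal_pow hs0.le, ENNReal.coe_pow]
  congr 2
  rw [Real.nnnorm_of_nonneg hs0.le, ENNReal.ofReal_eq_coe_nnreal hs0.le]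

theorem integrableOn_subSphere (hω : ‖ω‖ = 1) (hp0 : 0 ≤ p) (hp1 : p < 1)
    (R : MvPolynomial (Fin (n + 1)) ℂ) : IntegrableOn (evalAt R) (subSphere ω p) μHE[n - 1] := by
  rw [IntegrableOn, restrict_subSphere hω hp0 hp1]
  refine Integrable.smul_measure ?_ ENNReal.ofReal_ne_top
  have hgc : Continuous fun η : Metric.sphere (0 : EuclideanSpace ℝ (Fin n)) 1 =>
    p • ω + orthIsometry hω (√(1 - p ^ 2) • (η : EuclideanSpace ℝ (Fin n))) := by fun_prop
  rw [integrable_map_measure (continuous_evalAt R).aestronglyMeasurable hgc.measurable.aemeasurable]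
  simpa only [Function.comp_def, evalAt_affineSubst] using
    integrable_evalAt_toSphere (affineSubst (p • ω) (orthIsometry hω) R) √(1 - p ^ 2)

/-- Pizzetti's formula on the sub-sphere. -/
theorem hasSum_subSphere (hω : ‖ω‖ = 1) (hp0 : 0 ≤ p) (hp1 : p < 1)
    (R : MvPolynomial (Fin (n + 1)) ℂ) :
    HasSum (fun k : ℕ => (pizzettiCoeff n k : ℂ) * evalAt ((pizzettiOp ω ^ k) R) (p • ω) *
        (((1 - p ^ 2) ^ ((k : ℝ) + ((n : ℝ) - 1) / 2) : ℝ) : ℂ))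
      (∫ x in subSphere ω p, evalAt R x ∂μHE[n - 1]) := by
  have hpos := one_sub_sq_pos hp0 hp1
  have hs0 : 0 < √(1 - p ^ 2) := Real.sqrt_pos.2 hpos
  have hgc : Continuous fun η : Metric.sphere (0 : EuclideanSpace ℝ (Fin n)) 1 =>
    p • ω + orthIsometry hω (√(1 - p ^ 2) • (η : EuclideanSpace ℝ (Fin n))) := by fun_prop
  rw [restrict_subSphere hω hp0 hp1, integral_smul_measure,
    integral_map hgc.measurable.aemeasurable (continuous_evalAt R).aestronglyMeasurable,
    ENNReal.toReal_ofReal (by positivity), Complex.real_smul]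
  have h := (hasSum_integral_toSphere (affineSubst (p • ω) (orthIsometry hω) R)
    √(1 - p ^ 2)).mul_left ((√(1 - p ^ 2) ^ (n - 1) : ℝ) : ℂ)
  simp only [evalAt_affineSubst, evalAt_laplacian_pow_affineSubst] at h
  refine h.congr_fun ?_
  intro k
  have e : (1 - p ^ 2) ^ ((k : ℝ) + ((n : ℝ) - 1) / 2) =
      √(1 - p ^ 2) ^ (n - 1) * √(1 - p ^ 2) ^ (2 * k) := by
    rw [← pow_add, sqrt_pow_eq_rpow hpos.le]
    congr 1
    push_cast [Nat.cast_sub (NeZero.one_le (n := n))]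
    ring
  rw [e]
  push_cast
  ring

theorem integral_ball_of_isHomogeneous {ℓ : ℕ} {Q : MvPolynomial (Fin n) ℂ}
    (hQ : Q.IsHomogeneous ℓ) {s : ℝ} (hs : 0 ≤ s) :
    ∫ y in Metric.ball 0 s, evalAt Q y =
      (∫ η, evalAt Q (η : EuclideanSpace ℝ (Fin n))
        ∂(volume : Measure (EuclideanSpace ℝ (Fin n))).toSphere) *
      ((s ^ (n + ℓ) / ((n : ℝ) + ℓ) : ℝ) : ℂ) := by
  rw [← integral_indicator measurableSet_ball]
  rw [integral_polar_mul volume (fun η => evalAt Q η)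
    (fun r => (Set.Iio s).indicator (fun r : ℝ => (r : ℂ) ^ ℓ) r) (fun η r hr => ?_)]
  · congr 1
    have e : ∀ r : ℝ, (r : ℂ) ^ (Module.finrank ℝ (EuclideanSpace ℝ (Fin n)) - 1) *
        (Set.Iio s).indicator (fun r : ℝ => (r : ℂ) ^ ℓ) r =
        (Set.Iio s).indicator (fun r : ℝ => ((r ^ (n - 1 + ℓ) : ℝ) : ℂ)) r := fun r => by
      by_cases h : r ∈ Set.Iio s
      · simp [h, pow_add]
      · simp [h]
    simp only [e]
    rw [setIntegral_indicator measurableSet_Iio, Set.Ioi_inter_Iio, integral_complex_ofReal,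
      ← integral_Ioc_eq_integral_Ioo, ← intervalIntegral.integral_of_le hs, integral_pow]
    have hn : 1 ≤ n := NeZero.one_le
    have h1 : n - 1 + ℓ + 1 = n + ℓ := by omega
    rw [h1, zero_pow (by omega), sub_zero]
    congr 2
    push_cast [Nat.cast_sub hn]
    ring
  · by_cases h : r < s
    · rw [Set.indicator_of_mem (by simpa [norm_smul, abs_of_pos hr] using h),
        Set.indicator_of_mem (Set.mem_Iio.2 h), evalAt_smul_of_isHomogeneous hQ, mul_comm]
    · rw [Set.indicator_of_notMem (by simpa [norm_smul, abs_of_pos hr] using h),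
        Set.indicator_of_notMem (by simpa using h), mul_zero]

/-- Pizzetti's formula for balls centred at the origin. -/
theorem hasSum_integral_ball (Q : MvPolynomial (Fin n) ℂ) {s : ℝ} (hs : 0 ≤ s) :
    HasSum (fun k : ℕ => ((pizzettiCoeff n k / ((n : ℝ) + 2 * k) : ℝ) : ℂ) *
        evalAt ((laplacian n ^ k) Q) 0 * (s : ℂ) ^ (n + 2 * k))
      (∫ y in Metric.ball 0 s, evalAt Q y) := by
  induction Q using MvPolynomial.induction_on' with
  | monomial u a =>
    set Q := MvPolynomial.monomial u a
    have hQ : Q.IsHomogeneous u.degree := MvPolynomial.isHomogeneous_monomial a rfl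
    rw [integral_ball_of_isHomogeneous hQ hs]
    rcases Nat.even_or_odd' u.degree with ⟨k, hk | hk⟩
    · rw [hk] at hQ ⊢
      rw [integral_toSphere_of_even hQ]
      convert hasSum_single (f := fun k : ℕ => ((pizzettiCoeff n k / ((n : ℝ) + 2 * k) : ℝ) : ℂ) *
        evalAt ((laplacian n ^ k) Q) 0 * (s : ℂ) ^ (n + 2 * k)) k fun j hj => ?_ using 1
      · push_cast
        ring
      · rw [evalAt_zero_laplacian_pow hQ (by omega)]
        ring
    · rw [hk] at hQ ⊢
      rw [integral_toSphere_of_odd hQ, zero_mul]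
      have : ∀ j, evalAt ((laplacian n ^ j) Q) 0 = 0 := fun j =>
        evalAt_zero_laplacian_pow hQ (by omega)
      simp only [this, mul_zero, zero_mul]
      exact hasSum_zero
  | add p q hp hq =>
    simp only [map_add, evalAt_add, mul_add, add_mul]
    rw [integral_add (integrableOn_ball p s) (integrableOn_ball q s)]
    exact hp.add hq

/-- Pizzetti's formula on the sub-ball. -/
theorem hasSum_subBall (hω : ‖ω‖ = 1) (hp0 : 0 ≤ p) (hp1 : p < 1)
    (R : MvPolynomial (Fin (n + 1)) ℂ) :
    HasSum (fun k : ℕ => ((pizzettiCoeff n k / ((n : ℝ) + 2 * k) : ℝ) : ℂ) *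
        evalAt ((pizzettiOp ω ^ k) R) (p • ω) *
        (((1 - p ^ 2) ^ ((k : ℝ) + (n : ℝ) / 2) : ℝ) : ℂ))
      (∫ x in subBall ω p, evalAt R x ∂μHE[n]) := by
  have hpos := one_sub_sq_pos hp0 hp1
  have hi := isometry_add_orthIsometry hω (p • ω)
  rw [restrict_subBall hω hp0 hp1, integral_map hi.continuous.measurable.aemeasurable
    (continuous_evalAt R).aestronglyMeasurable]
  have h := hasSum_integral_ball (affineSubst (p • ω) (orthIsometry hω) R)
    (Real.sqrt_nonneg (1 - p ^ 2))
  simp only [evalAt_affineSubst, evalAt_laplacian_pow_affineSubst] at h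
  refine h.congr_fun ?_
  intro k
  have e : (1 - p ^ 2) ^ ((k : ℝ) + (n : ℝ) / 2) = √(1 - p ^ 2) ^ (n + 2 * k) := by
    rw [sqrt_pow_eq_rpow hpos.le]
    congr 1
    push_cast
    ring
  rw [e]
  push_cast
  ring

end Hyperplane

/-! ### A Gaussian integral over a half-plane in two coordinate systems -/

theorem image_cos_Ioo : Real.cos '' Set.Ioo 0 π = Set.Ioo (-1) 1 := by
  ext t
  constructor
  · rintro ⟨θ, hθ, rfl⟩
    have h1 := Real.strictAntiOn_cos ⟨le_rfl, Real.pi_pos.le⟩ ⟨hθ.1.le, hθ.2.le⟩ hθ.1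
    have h2 := Real.strictAntiOn_cos ⟨hθ.1.le, hθ.2.le⟩ ⟨Real.pi_pos.le, le_rfl⟩ hθ.2
    rw [Real.cos_zero] at h1
    rw [Real.cos_pi] at h2
    exact ⟨h2, h1⟩
  · rintro ⟨h1, h2⟩
    refine ⟨Real.arccos t, ⟨Real.arccos_pos.2 h2, ?_⟩, Real.cos_arccos h1.le h2.le⟩
    refine lt_of_le_of_ne (Real.arccos_le_pi t) fun h => ?_
    have := Real.arccos_eq_pi.1 h
    linarith

theorem injOn_cos_Ioo : Set.InjOn Real.cos (Set.Ioo 0 π) :=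
  Real.injOn_cos.mono Set.Ioo_subset_Icc_self

theorem abs_sin_mul_density {θ : ℝ} (hθ : θ ∈ Set.Ioo 0 π) (a c : ℕ) :
    |-Real.sin θ| * (Real.cos θ ^ a * (1 - Real.cos θ ^ 2) ^ (((c : ℝ) - 1) / 2)) =
      Real.cos θ ^ a * Real.sin θ ^ c := by
  have hs : 0 < Real.sin θ := Real.sin_pos_of_pos_of_lt_pi hθ.1 hθ.2
  have h1 : 1 - Real.cos θ ^ 2 = Real.sin θ ^ (2 : ℝ) := by
    rw [Real.rpow_two, Real.sin_sq]
  rw [abs_neg, abs_of_pos hs, h1, ← Real.rpow_mul hs.le, mul_left_comm]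
  congr 1
  conv_lhs => rw [← Real.rpow_one (Real.sin θ), ← Real.rpow_mul hs.le, ← Real.rpow_add hs]
  rw [← Real.rpow_natCast]
  congr 1
  ring

/-- The substitution `t = cos θ`. -/
theorem integral_cos_pow_mul_sin_pow (χ : ℝ → ℝ) (a c : ℕ) :
    ∫ θ in Set.Ioo 0 π, χ (Real.cos θ) * (Real.cos θ ^ a * Real.sin θ ^ c) =
      ∫ t in Set.Ioo (-1 : ℝ) 1, χ t * (t ^ a * (1 - t ^ 2) ^ (((c : ℝ) - 1) / 2)) := by
  rw [← image_cos_Ioo, integral_image_eq_integral_abs_deriv_smul measurableSet_Ioo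
    (fun θ _ => (Real.hasDerivAt_cos θ).hasDerivWithinAt) injOn_cos_Ioo]
  refine setIntegral_congr_fun measurableSet_Ioo fun θ hθ => ?_
  simp only [smul_eq_mul]
  rw [← abs_sin_mul_density hθ]
  ring

/-- The density of the last coordinate is integrable even where its exponent is negative, because
it becomes bounded after the substitution `t = cos θ`. -/
theorem integrableOn_density (a c : ℕ) :
    IntegrableOn (fun t : ℝ => t ^ a * (1 - t ^ 2) ^ (((c : ℝ) - 1) / 2)) (Set.Ioo (-1) 1) := by
  rw [← image_cos_Ioo, integrableOn_image_iff_integrableOn_abs_deriv_smul measurableSet_Ioo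
    (fun θ _ => (Real.hasDerivAt_cos θ).hasDerivWithinAt) injOn_cos_Ioo]
  have h : IntegrableOn (fun θ : ℝ => Real.cos θ ^ a * Real.sin θ ^ c) (Set.Ioo 0 π) :=
    (Continuous.continuousOn (by fun_prop)).integrableOn_compact isCompact_Icc |>.mono_set
      Set.Ioo_subset_Icc_self
  refine h.congr_fun (fun θ hθ => ?_) measurableSet_Ioo
  rw [smul_eq_mul, abs_sin_mul_density hθ]

/-- A Gaussian integral over the half-plane `ρ > 0`, with an angular weight `χ`, in polar
coordinates. -/
theorem integral_halfPlane (χ : ℝ → ℝ) (a c : ℕ) :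
    ∫ q : ℝ × ℝ, χ (q.1 / √(q.1 ^ 2 + q.2 ^ 2)) *
        ((q.1 ^ a * rexp (-q.1 ^ 2)) * (q.2 ^ c * rexp (-q.2 ^ 2)))
        ∂((volume : Measure ℝ).prod (volume.restrict (Set.Ioi 0))) =
      Real.Gamma (((a : ℝ) + c + 2) / 2) / 2 *
        ∫ t in Set.Ioo (-1 : ℝ) 1, χ t * (t ^ a * (1 - t ^ 2) ^ (((c : ℝ) - 1) / 2)) := by
  set f : ℝ × ℝ → ℝ := fun q => χ (q.1 / √(q.1 ^ 2 + q.2 ^ 2)) *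
        ((q.1 ^ a * rexp (-q.1 ^ 2)) * (q.2 ^ c * rexp (-q.2 ^ 2))) with hf
  have h1 : ∫ q, f q ∂((volume : Measure ℝ).prod (volume.restrict (Set.Ioi 0))) =
      ∫ q : ℝ × ℝ, ((Set.univ : Set ℝ) ×ˢ Set.Ioi (0 : ℝ)).indicator f q := by
    rw [integral_indicator (MeasurableSet.univ.prod measurableSet_Ioi)]
    rw [Measure.volume_eq_prod, ← Measure.prod_restrict, Measure.restrict_univ]
  have h2 : ∀ q ∈ polarCoord.target,
      q.1 • ((Set.univ : Set ℝ) ×ˢ Set.Ioi (0 : ℝ)).indicator f (polarCoord.symm q) =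
        (Set.Ioi (0 : ℝ) ×ˢ Set.Ioo 0 π).indicator (fun q => (q.1 ^ (a + c + 1) * rexp (-q.1 ^ 2)) *
          (χ (Real.cos q.2) * (Real.cos q.2 ^ a * Real.sin q.2 ^ c))) q := by
    rintro ⟨r, θ⟩ ⟨hr, hθ⟩
    simp only [Set.mem_Ioi] at hr
    simp only [Set.mem_Ioo] at hθ
    rw [polarCoord_symm_apply]
    by_cases h : 0 < θ
    · have hs : 0 < Real.sin θ := Real.sin_pos_of_pos_of_lt_pi h hθ.2
      rw [Set.indicator_of_mem (by simp [mul_pos hr hs]),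
        Set.indicator_of_mem (by simp [hr, h, hθ.2]), hf]
      simp only
      have e : (r * Real.cos θ) ^ 2 + (r * Real.sin θ) ^ 2 = r ^ 2 := by
        rw [mul_pow, mul_pow, ← mul_add, Real.cos_sq_add_sin_sq, mul_one]
      have e2 : rexp (-(r * Real.cos θ) ^ 2) * rexp (-(r * Real.sin θ) ^ 2) = rexp (-r ^ 2) := by
        rw [← Real.exp_add, ← e]; ring_nf
      rw [e, Real.sqrt_sq hr.le, mul_div_cancel_left₀ _ hr.ne', ← e2, smul_eq_mul]
      ring
    · have hs : Real.sin θ ≤ 0 := Real.sin_nonpos_of_nonpos_of_neg_pi_le (not_lt.1 h) hθ.1.le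
      rw [Set.indicator_of_notMem, Set.indicator_of_notMem, smul_zero]
      · simp [h]
      · simpa using mul_nonpos_of_nonneg_of_nonpos hr.le hs
  have hm : MeasurableSet polarCoord.target := polarCoord.open_target.measurableSet
  have hsub : Set.Ioi (0 : ℝ) ×ˢ Set.Ioo 0 π ⊆ polarCoord.target := by
    rintro ⟨r, θ⟩ ⟨hr, hθ⟩
    exact ⟨hr, (neg_lt_zero.2 Real.pi_pos).trans hθ.1, hθ.2⟩
  rw [h1, ← integral_comp_polarCoord_symm, setIntegral_congr_fun hm h2,
    setIntegral_indicator (measurableSet_Ioi.prod measurableSet_Ioo),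
    Set.inter_eq_self_of_subset_right hsub, Measure.volume_eq_prod,
    setIntegral_prod_mul (fun r : ℝ => r ^ (a + c + 1) * rexp (-r ^ 2))
      (fun θ : ℝ => χ (Real.cos θ) * (Real.cos θ ^ a * Real.sin θ ^ c)),
    integral_Ioi_pow_mul_exp_neg_sq, integral_cos_pow_mul_sin_pow]
  congr 4
  push_cast
  ring

/-! ### The cap coefficients -/

theorem integral_zero_one_density (a c : ℕ) :
    ∫ t in (0 : ℝ)..1, t ^ a * (1 - t ^ 2) ^ (((c : ℝ) - 1) / 2) =
      Real.Gamma (((a : ℝ) + 1) / 2) * Real.Gamma (((c : ℝ) + 1) / 2) /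
        (2 * Real.Gamma (((a : ℝ) + c + 2) / 2)) := by
  have h := integral_halfPlane ((Set.Ioi (0 : ℝ)).indicator 1) a c
  have hR : ∫ t in Set.Ioo (-1 : ℝ) 1, (Set.Ioi (0 : ℝ)).indicator 1 t *
      (t ^ a * (1 - t ^ 2) ^ (((c : ℝ) - 1) / 2)) =
      ∫ t in (0 : ℝ)..1, t ^ a * (1 - t ^ 2) ^ (((c : ℝ) - 1) / 2) := by
    have e : ∀ t : ℝ, (Set.Ioi (0 : ℝ)).indicator 1 t *
        (t ^ a * (1 - t ^ 2) ^ (((c : ℝ) - 1) / 2)) = (Set.Ioi (0 : ℝ)).indicator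
          (fun t => t ^ a * (1 - t ^ 2) ^ (((c : ℝ) - 1) / 2)) t := fun t => by
      by_cases ht : t ∈ Set.Ioi (0 : ℝ) <;> simp [ht]
    simp only [e]
    rw [setIntegral_indicator measurableSet_Ioi, Set.Ioo_inter_Ioi, sup_of_le_right (by norm_num),
      intervalIntegral.integral_of_le zero_le_one, integral_Ioc_eq_integral_Ioo]
  have hL : ∫ q : ℝ × ℝ, (Set.Ioi (0 : ℝ)).indicator 1 (q.1 / √(q.1 ^ 2 + q.2 ^ 2)) *
        ((q.1 ^ a * rexp (-q.1 ^ 2)) * (q.2 ^ c * rexp (-q.2 ^ 2)))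
        ∂((volume : Measure ℝ).prod (volume.restrict (Set.Ioi 0))) =
      Real.Gamma (((a : ℝ) + 1) / 2) / 2 * (Real.Gamma (((c : ℝ) + 1) / 2) / 2) := by
    rw [← integral_Ioi_pow_mul_exp_neg_sq, ← integral_Ioi_pow_mul_exp_neg_sq,
      ← integral_indicator (f := fun r : ℝ => r ^ a * rexp (-r ^ 2)) measurableSet_Ioi,
      ← integral_prod_mul]
    have hae : ∀ᵐ q : ℝ × ℝ ∂((volume : Measure ℝ).prod (volume.restrict (Set.Ioi 0))),
        q.2 ∈ Set.Ioi (0 : ℝ) := by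
      have : ((volume : Measure ℝ).prod (volume.restrict (Set.Ioi (0 : ℝ)))) =
          ((volume : Measure ℝ).prod volume).restrict (Set.univ ×ˢ Set.Ioi 0) := by
        rw [← Measure.prod_restrict, Measure.restrict_univ]
      rw [this]
      filter_upwards [ae_restrict_mem (MeasurableSet.univ.prod measurableSet_Ioi)] with q hq
      exact hq.2
    refine integral_congr_ae ?_
    filter_upwards [hae] with q hq
    have hq' : 0 < √(q.1 ^ 2 + q.2 ^ 2) := Real.sqrt_pos.2 (by
      have : 0 < q.2 := hq
      positivity)
    by_cases h1 : 0 < q.1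
    · rw [Set.indicator_of_mem (Set.mem_Ioi.2 (div_pos h1 hq')),
        Set.indicator_of_mem (Set.mem_Ioi.2 h1)]
      simp
    · rw [Set.indicator_of_notMem, Set.indicator_of_notMem (by simpa using h1), zero_mul, zero_mul]
      simpa using div_nonpos_of_nonpos_of_nonneg (not_lt.1 h1) hq'.le
  rw [hL, hR] at h
  have hG : Real.Gamma (((a : ℝ) + c + 2) / 2) ≠ 0 :=
    (Real.Gamma_pos_of_pos (by positivity)).ne'
  rw [eq_div_iff (mul_ne_zero two_ne_zero hG)]
  linear_combination -4 * h

/-- The binomial series, with coefficients written as in the hypergeometric series. -/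
theorem hasSum_one_sub_rpow (b : ℝ) {u : ℝ} (hu : |u| < 1) :
    HasSum (fun n : ℕ => ((n ! : ℝ)⁻¹ * Polynomial.eval (-b) (ascPochhammer ℝ n)) * u ^ n)
      ((1 - u) ^ b) := by
  have h := (Real.one_add_rpow_hasFPowerSeriesOnBall_zero (a := b)).hasSum (y := -u) (by
    rw [Metric.mem_eball, edist_zero_right, ← ofReal_norm, ENNReal.ofReal_lt_one, norm_neg]
    exact hu)
  have h1 : ∀ k : ℕ, (k : ℝ) ≠ -1 := fun k hk => by
    have : (0 : ℝ) ≤ k := k.cast_nonneg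
    linarith
  rw [binomialSeries_eq_ordinaryHypergeometricSeries h1, zero_add, ← sub_eq_add_neg] at h
  refine h.congr_fun fun n => ?_
  have h2 : Polynomial.eval (1 : ℝ) (ascPochhammer ℝ n) ≠ 0 := by
    rw [ascPochhammer_eval_one]; exact_mod_cast n.factorial_ne_zero
  have h3 := ordinaryHypergeometricSeries_apply_eq (𝔸 := ℝ) (-b) 1 1 u n
  rw [mul_inv_cancel_right₀ h2, smul_eq_mul] at h3
  rw [← h3, FormalMultilinearSeries.compContinuousLinearMap_apply]
  congr 1
  ext i
  simp

theorem ascPochhammer_eval_add_one {A : ℝ} (hA : 0 < A) (n : ℕ) :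
    Polynomial.eval A (ascPochhammer ℝ n) * (Polynomial.eval (A + 1) (ascPochhammer ℝ n))⁻¹ =
      A / (A + n) := by
  have h1 := ascPochhammer_succ_eval (S := ℝ) n A
  rw [ascPochhammer_succ_left, Polynomial.eval_mul, Polynomial.eval_X, Polynomial.eval_comp] at h1
  simp only [Polynomial.eval_add, Polynomial.eval_X, Polynomial.eval_one] at h1
  have h2 : Polynomial.eval (A + 1) (ascPochhammer ℝ n) ≠ 0 :=
    (ascPochhammer_pos n (A + 1) (by linarith)).ne'
  have h3 : A + n ≠ 0 := by positivity
  field_simp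
  linarith

/-- The incomplete beta integral as a hypergeometric function: integrate the binomial series term
by term. -/
theorem integral_zero_density (a : ℕ) (b : ℝ) {p : ℝ} (hp0 : 0 ≤ p) (hp1 : p < 1) :
    ∫ t in (0 : ℝ)..p, t ^ a * (1 - t ^ 2) ^ b =
      p ^ (a + 1) / ((a : ℝ) + 1) *
        ordinaryHypergeometric (-b) (((a : ℝ) + 1) / 2) (((a : ℝ) + 1) / 2 + 1) (p ^ 2) := by
  set c : ℕ → ℝ := fun n => (n ! : ℝ)⁻¹ * Polynomial.eval (-b) (ascPochhammer ℝ n) with hc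
  have hpp : |p ^ 2| < 1 := by rw [abs_of_nonneg (sq_nonneg p)]; nlinarith
  let f : ℕ → C(ℝ, ℝ) := fun n => ⟨fun t => c n * t ^ (a + 2 * n), by fun_prop⟩
  have hsum : Summable fun n => ‖(f n).restrict
      (⟨Set.uIcc 0 p, isCompact_uIcc⟩ : TopologicalSpace.Compacts ℝ)‖ := by
    have h1 : Summable fun n => p ^ a * ‖c n * (p ^ 2) ^ n‖ :=
      (hasSum_one_sub_rpow b hpp).summable.norm.mul_left _
    refine h1.of_nonneg_of_le (fun n => norm_nonneg _) fun n => ?_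
    rw [ContinuousMap.norm_le _ (by positivity)]
    rintro ⟨t, ht⟩
    have ht' : t ∈ Set.Icc 0 p := by rwa [← Set.uIcc_of_le hp0]
    change ‖c n * t ^ (a + 2 * n)‖ ≤ _
    rw [norm_mul (c n), norm_mul (c n), norm_pow, norm_pow, norm_pow, ← pow_mul, Real.norm_of_nonneg ht'.1,
      Real.norm_of_nonneg hp0, mul_left_comm, ← pow_add]
    gcongr
    exacts [ht'.1, ht'.2]
  have h := intervalIntegral.hasSum_intervalIntegral_of_summable_norm hsum
  have hval : ∫ t in (0 : ℝ)..p, ∑' n, f n t = ∫ t in (0 : ℝ)..p, t ^ a * (1 - t ^ 2) ^ b := by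
    refine intervalIntegral.integral_congr fun t ht => ?_
    rw [Set.uIcc_of_le hp0] at ht
    have htt : |t ^ 2| < 1 := by
      rw [abs_of_nonneg (sq_nonneg t)]; nlinarith [ht.1, ht.2]
    have h2 := (hasSum_one_sub_rpow b htt).mul_left (t ^ a)
    refine Eq.trans (tsum_congr fun n => ?_) h2.tsum_eq
    change c n * t ^ (a + 2 * n) = t ^ a * (c n * (t ^ 2) ^ n)
    rw [pow_add, pow_mul]; ring
  rw [hval] at h
  have hterm : ∀ n, ∫ t in (0 : ℝ)..p, f n t = p ^ (a + 1) / ((a : ℝ) + 1) *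
      (((n ! : ℝ)⁻¹ * Polynomial.eval (-b) (ascPochhammer ℝ n) *
        Polynomial.eval (((a : ℝ) + 1) / 2) (ascPochhammer ℝ n) *
          (Polynomial.eval (((a : ℝ) + 1) / 2 + 1) (ascPochhammer ℝ n))⁻¹) • (p ^ 2) ^ n) := by
    intro n
    change ∫ t in (0 : ℝ)..p, c n * t ^ (a + 2 * n) = _
    rw [intervalIntegral.integral_const_mul, integral_pow, zero_pow (by omega), sub_zero, smul_eq_mul,
      mul_assoc _ (Polynomial.eval (((a : ℝ) + 1) / 2) (ascPochhammer ℝ n)),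
      ascPochhammer_eval_add_one (by positivity)]
    have h1 : (a : ℝ) + 1 ≠ 0 := by positivity
    have h2 : (a : ℝ) + 1 + 2 * n ≠ 0 := by positivity
    have h3 : ((a : ℝ) + 1) / 2 + n ≠ 0 := by positivity
    have h4 : ((a + 2 * n : ℕ) : ℝ) + 1 ≠ 0 := by positivity
    have h5 : ((a : ℝ) + 1) / 2 / (((a : ℝ) + 1) / 2 + n) =
        ((a : ℝ) + 1) / (((a + 2 * n : ℕ) : ℝ) + 1) := by
      rw [div_eq_div_iff h3 h4]; push_cast; ring
    rw [h5, ← pow_mul, show a + 2 * n + 1 = (a + 1) + 2 * n by ring, pow_add p (a + 1)]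
    change c n * _ = _ * (c n * _ * _)
    field_simp
  simp only [hterm] at h
  rw [ordinaryHypergeometric_eq_tsum]
  simp only
  rw [← tsum_mul_left, h.tsum_eq]

variable {m k ℓ : ℕ}

/-- With `a = ℓ - 2k` and `c = 2k + m - 2`, `capDensity` is the density `t^a (1 - t²)^((c-1)/2)`. -/
theorem capDensity_eq (hm : 2 ≤ m) (k ℓ : ℕ) :
    capDensity m k ℓ = fun t =>
      t ^ (ℓ - 2 * k) * (1 - t ^ 2) ^ ((((2 * k + m - 2 : ℕ) : ℝ) - 1) / 2) := by
  ext t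
  rw [capDensity]
  congr 2
  push_cast [Nat.cast_sub (show 2 ≤ 2 * k + m by omega)]
  ring

theorem integrableOn_capDensity (hm : 2 ≤ m) (k ℓ : ℕ) :
    IntegrableOn (capDensity m k ℓ) (Set.Ioo (-1) 1) := by
  rw [capDensity_eq hm]
  exact integrableOn_density _ _

theorem intervalIntegrable_capDensity (hm : 2 ≤ m) (k ℓ : ℕ) {a b : ℝ} (ha : -1 ≤ a)
    (hab : a ≤ b) (hb : b ≤ 1) : IntervalIntegrable (capDensity m k ℓ) volume a b := by
  rw [intervalIntegrable_iff_integrableOn_Ioo_of_le hab]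
  exact (integrableOn_capDensity hm k ℓ).mono_set (Set.Ioo_subset_Ioo ha hb)

theorem integral_zero_one_capDensity (hm : 2 ≤ m) (hk : 2 * k ≤ ℓ) :
    ∫ t in (0 : ℝ)..1, capDensity m k ℓ t =
      Real.Gamma (((ℓ : ℝ) + 1) / 2 - k) * Real.Gamma ((k : ℝ) + ((m : ℝ) - 1) / 2) /
        (2 * Real.Gamma (((ℓ : ℝ) + m) / 2)) := by
  rw [capDensity_eq hm, integral_zero_one_density]
  push_cast [Nat.cast_sub hk, Nat.cast_sub (show 2 ≤ 2 * k + m by omega)]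
  congr 3 <;> (try congr 1) <;> ring

theorem integral_zero_capDensity (hk : 2 * k ≤ ℓ) {p : ℝ} (hp0 : 0 ≤ p) (hp1 : p < 1) :
    ∫ t in (0 : ℝ)..p, capDensity m k ℓ t =
      p ^ (ℓ - 2 * k + 1) / ((ℓ : ℝ) - 2 * k + 1) *
        ordinaryHypergeometric (-(k : ℝ) - ((m : ℝ) - 3) / 2) (((ℓ : ℝ) + 1) / 2 - k)
          (((ℓ : ℝ) + 3) / 2 - k) (p ^ 2) := by
  simp only [capDensity]
  rw [integral_zero_density _ _ hp0 hp1]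
  push_cast [Nat.cast_sub hk]
  congr 2 <;> ring

theorem integral_neg_one_zero_capDensity (hk : 2 * k ≤ ℓ) :
    ∫ t in (-1 : ℝ)..0, capDensity m k ℓ t = (-1) ^ ℓ * ∫ t in (0 : ℝ)..1, capDensity m k ℓ t := by
  have h := intervalIntegral.integral_comp_neg (a := 0) (b := 1) (capDensity m k ℓ)
  rw [neg_zero] at h
  rw [← h, ← intervalIntegral.integral_const_mul]
  refine intervalIntegral.integral_congr fun t _ => ?_
  have h1 : (-1 : ℝ) ^ ℓ = (-1) ^ (ℓ - 2 * k) := by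
    conv_lhs => rw [← Nat.sub_add_cancel hk, pow_add, pow_mul (-1 : ℝ) 2 k]
    simp
  simp only [capDensity]
  rw [h1, neg_pow t, neg_sq, mul_assoc]

/-! ### Spherical caps -/

section Cap

variable {n : ℕ} {ω : EuclideanSpace ℝ (Fin (n + 1))}

theorem integrable_pow_mul_exp_neg_sq (a : ℕ) :
    Integrable fun r : ℝ => r ^ a * rexp (-r ^ 2) := by
  have h := integrable_rpow_mul_exp_neg_mul_sq one_pos (s := a)
    (by have : (0 : ℝ) ≤ a := a.cast_nonneg; linarith)
  simpa only [Real.rpow_natCast, neg_mul, one_mul] using h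

theorem integrable_halfPlane {χ : ℝ → ℝ} (hχ : Measurable χ) (hχ1 : ∀ t, |χ t| ≤ 1) (a c : ℕ) :
    Integrable (fun q : ℝ × ℝ => χ (q.1 / √(q.1 ^ 2 + q.2 ^ 2)) *
      ((q.1 ^ a * rexp (-q.1 ^ 2)) * (q.2 ^ c * rexp (-q.2 ^ 2))))
      ((volume : Measure ℝ).prod (volume.restrict (Set.Ioi 0))) := by
  refine Integrable.bdd_mul (c := 1) ?_ ?_ (.of_forall fun q => hχ1 _)
  · exact (integrable_pow_mul_exp_neg_sq a).mul_prod (integrableOn_Ioi_pow_mul_exp_neg_sq c)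
  · exact (hχ.comp (by fun_prop)).aestronglyMeasurable

/-- The part of the unit sphere where `⟨x, ω⟩` lies in `T`. -/
def sphereSlice (ω : EuclideanSpace ℝ (Fin (n + 1))) (T : Set ℝ) :
    Set (EuclideanSpace ℝ (Fin (n + 1))) :=
  {x ∈ Metric.sphere 0 1 | inner ℝ x ω ∈ T}

theorem restrict_sphere :
    (μHE[n]).restrict (Metric.sphere (0 : EuclideanSpace ℝ (Fin (n + 1))) 1) =
      Measure.map Subtype.val (volume : Measure (EuclideanSpace ℝ (Fin (n + 1)))).toSphere := by
  have h := (isometry_subtype_coe (s := Metric.sphere (0 : EuclideanSpace ℝ (Fin (n + 1))) 1)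
    ).map_euclideanHausdorffMeasure (d := n)
  rw [Subtype.range_coe] at h
  rw [← h, ← euclideanHausdorffMeasure_sphere_fin (n := n + 1)]
  rfl

theorem integrableOn_sphereSlice (T : Set ℝ) (R : MvPolynomial (Fin (n + 1)) ℂ) :
    IntegrableOn (evalAt R) (sphereSlice ω T) μHE[n] := by
  have h : IntegrableOn (evalAt R) (Metric.sphere 0 1) μHE[n] := by
    rw [IntegrableOn, restrict_sphere, integrable_map_measure
      (continuous_evalAt R).aestronglyMeasurable measurable_subtype_coe.aemeasurable]
    simpa [Function.comp_def] using integrable_evalAt_toSphere R 1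
  exact h.mono_set fun x hx => hx.1

variable [NeZero n]

/-- A homogeneous polynomial integrated over the sphere against a function of `⟨x, ω⟩`. Both sides
are multiplied by a radial Gaussian integral; then the left side is an integral over `ℝⁿ⁺¹`, which
is evaluated by Pizzetti's formula in each hyperplane orthogonal to `ω`. -/
theorem integral_toSphere_weight (hω : ‖ω‖ = 1) {χ : ℝ → ℝ} (hχ : Measurable χ)
    (hχ1 : ∀ t, |χ t| ≤ 1) {ℓ : ℕ} {R : MvPolynomial (Fin (n + 1)) ℂ} (hR : R.IsHomogeneous ℓ) :
    ∫ η : Metric.sphere (0 : EuclideanSpace ℝ (Fin (n + 1))) 1,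
        (χ (inner ℝ (η : EuclideanSpace ℝ (Fin (n + 1))) ω) : ℂ) * evalAt R η
        ∂(volume : Measure (EuclideanSpace ℝ (Fin (n + 1)))).toSphere =
      ∑ k ∈ Finset.range (ℓ / 2 + 1), (pizzettiCoeff n k : ℂ) *
        ((∫ t in Set.Ioo (-1 : ℝ) 1, χ t *
          (t ^ (ℓ - 2 * k) * (1 - t ^ 2) ^ ((((2 * k + n - 1 : ℕ) : ℝ) - 1) / 2)) : ℝ) : ℂ) *
        evalAt ((pizzettiOp ω ^ k) R) ω := by
  have hn : 1 ≤ n := NeZero.one_le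
  set f : EuclideanSpace ℝ (Fin (n + 1)) → ℂ := fun x =>
    (χ (inner ℝ x ω / ‖x‖) : ℂ) * (evalAt R x * (rexp (-‖x‖ ^ 2) : ℂ)) with hf
  have hfint : Integrable f := by
    refine Integrable.bdd_mul (c := 1) (integrable_evalAt_mul_exp R) ?_
      (.of_forall fun x => by rw [Complex.norm_real]; exact hχ1 _)
    refine (Complex.measurable_ofReal.comp (hχ.comp ?_)).aestronglyMeasurable
    have h1 : Measurable fun x : EuclideanSpace ℝ (Fin (n + 1)) => inner ℝ x ω :=
      Continuous.measurable (by fun_prop)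
    exact h1.div measurable_norm
  -- the radial factor splits off in polar coordinates of `ℝⁿ⁺¹`
  have hpolar : ∫ x, f x =
      (∫ η : Metric.sphere (0 : EuclideanSpace ℝ (Fin (n + 1))) 1,
        (χ (inner ℝ (η : EuclideanSpace ℝ (Fin (n + 1))) ω) : ℂ) * evalAt R η
        ∂(volume : Measure (EuclideanSpace ℝ (Fin (n + 1)))).toSphere) *
      ((Real.Gamma (((ℓ : ℝ) + n + 1) / 2) / 2 : ℝ) : ℂ) := by
    rw [integral_polar_mul volume (fun η => (χ (inner ℝ (η : EuclideanSpace ℝ (Fin (n + 1))) ω) : ℂ) *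
      evalAt R η) (fun r => (r : ℂ) ^ ℓ * (rexp (-r ^ 2) : ℂ)) (fun η r hr => ?_)]
    · congr 1
      simp only [← mul_assoc, ← pow_add]
      rw [integral_Ioi_pow_mul_exp_neg_sq_complex, finrank_euclideanSpace, Fintype.card_fin]
      congr 4
      push_cast
      ring
    · simp only [hf]
      rw [inner_smul_left, norm_smul, norm_eq_of_mem_sphere, mul_one, Real.norm_of_nonneg hr.le,
        evalAt_smul_of_isHomogeneous hR, conj_trivial, mul_div_cancel_left₀ _ hr.ne']
      ring
  -- the same integral in the coordinates `s • ω + L y`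
  have hmp := measurePreserving_smul_add_orthIsometry hω
  set F : ℝ × EuclideanSpace ℝ (Fin n) → ℂ := fun q => f (q.1 • ω + orthIsometry hω q.2) with hF
  have hFint : Integrable F ((volume : Measure ℝ).prod volume) :=
    hmp.integrable_comp_of_integrable hfint
  have hFeq : ∫ x, f x = ∫ s : ℝ, ∫ y : EuclideanSpace ℝ (Fin n), F (s, y) := by
    rw [← integral_prod F hFint, ← hmp.map_eq,
      integral_map hmp.measurable.aemeasurable (by rw [hmp.map_eq]; exact hfint.1)]
    rfl
  have hFval : ∀ (s r : ℝ), 0 < r → ∀ η : Metric.sphere (0 : EuclideanSpace ℝ (Fin n)) 1,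
      F (s, r • (η : EuclideanSpace ℝ (Fin n))) =
        ((χ (s / √(s ^ 2 + r ^ 2)) * (rexp (-s ^ 2) * rexp (-r ^ 2)) : ℝ) : ℂ) *
          evalAt (affineSubst (s • ω) (orthIsometry hω) R) (r • (η : EuclideanSpace ℝ (Fin n))) := by
    intro s r hr η
    have h1 := norm_sq_smul_add_orthIsometry hω s (r • (η : EuclideanSpace ℝ (Fin n)))
    rw [norm_smul, norm_eq_of_mem_sphere, mul_one, Real.norm_of_nonneg hr.le] at h1
    have h2 : ‖s • ω + orthIsometry hω (r • (η : EuclideanSpace ℝ (Fin n)))‖ =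
        √(s ^ 2 + r ^ 2) := by rw [← h1, Real.sqrt_sq (norm_nonneg _)]
    simp only [hF, hf]
    rw [evalAt_affineSubst, inner_smul_add_orthIsometry_left, h1, h2, neg_add, Real.exp_add]
    push_cast
    ring
  -- Pizzetti's formula on the spheres of radius `r` in the hyperplane at height `s`
  have hsph : ∀ s r : ℝ, ∫ η, evalAt (affineSubst (s • ω) (orthIsometry hω) R)
        (r • (η : EuclideanSpace ℝ (Fin n)))
        ∂(volume : Measure (EuclideanSpace ℝ (Fin n))).toSphere =
      ∑ k ∈ Finset.range (ℓ / 2 + 1), (pizzettiCoeff n k : ℂ) *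
        ((s : ℂ) ^ (ℓ - 2 * k) * evalAt ((pizzettiOp ω ^ k) R) ω) * (r : ℂ) ^ (2 * k) := by
    intro s r
    have h := hasSum_integral_toSphere (affineSubst (s • ω) (orthIsometry hω) R) r
    simp only [evalAt_laplacian_pow_affineSubst,
      evalAt_smul_of_isHomogeneous (isHomogeneous_pizzettiOp_pow hR ω _)] at h
    refine h.unique (hasSum_sum_of_ne_finset_zero fun k hk => ?_)
    rw [Finset.mem_range, not_lt] at hk
    rw [pizzettiOp_pow_eq_zero hR ω (by omega), evalAt_zero]
    ring
  set G : ℝ × ℝ → ℂ := fun q => ∑ k ∈ Finset.range (ℓ / 2 + 1),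
    ((pizzettiCoeff n k : ℂ) * evalAt ((pizzettiOp ω ^ k) R) ω) *
      ((χ (q.1 / √(q.1 ^ 2 + q.2 ^ 2)) * ((q.1 ^ (ℓ - 2 * k) * rexp (-q.1 ^ 2)) *
        (q.2 ^ (2 * k + n - 1) * rexp (-q.2 ^ 2))) : ℝ) : ℂ) with hG
  have hGint : ∀ k ∈ Finset.range (ℓ / 2 + 1), Integrable (fun q : ℝ × ℝ =>
      ((pizzettiCoeff n k : ℂ) * evalAt ((pizzettiOp ω ^ k) R) ω) *
        ((χ (q.1 / √(q.1 ^ 2 + q.2 ^ 2)) * ((q.1 ^ (ℓ - 2 * k) * rexp (-q.1 ^ 2)) *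
          (q.2 ^ (2 * k + n - 1) * rexp (-q.2 ^ 2))) : ℝ) : ℂ))
      ((volume : Measure ℝ).prod (volume.restrict (Set.Ioi 0))) := fun k _ =>
    ((integrable_halfPlane hχ hχ1 _ _).ofReal).const_mul _
  have hinner : ∀ᵐ s : ℝ, ∫ y : EuclideanSpace ℝ (Fin n), F (s, y) =
      ∫ r in Set.Ioi (0 : ℝ), G (s, r) := by
    filter_upwards [hFint.prod_right_ae] with s hs
    rw [integral_eq_integral_polar volume hs]
    refine setIntegral_congr_fun measurableSet_Ioi fun r hr => ?_
    simp only [hFval s r hr]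
    rw [integral_const_mul, hsph, finrank_euclideanSpace, Fintype.card_fin, Complex.real_smul,
      hG, Finset.mul_sum, Finset.mul_sum]
    refine Finset.sum_congr rfl fun k _ => ?_
    rw [show 2 * k + n - 1 = (n - 1) + 2 * k by omega, pow_add r]
    push_cast
    ring
  have hfinal : ∫ x, f x = ∑ k ∈ Finset.range (ℓ / 2 + 1),
      ((pizzettiCoeff n k : ℂ) * evalAt ((pizzettiOp ω ^ k) R) ω) *
        ((Real.Gamma (((ℓ : ℝ) + n + 1) / 2) / 2 * ∫ t in Set.Ioo (-1 : ℝ) 1, χ t *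
          (t ^ (ℓ - 2 * k) * (1 - t ^ 2) ^ ((((2 * k + n - 1 : ℕ) : ℝ) - 1) / 2)) : ℝ) : ℂ) := by
    rw [hFeq, integral_congr_ae hinner, ← integral_prod G (integrable_finsetSum _ hGint), hG,
      integral_finsetSum _ hGint]
    refine Finset.sum_congr rfl fun k hk => ?_
    rw [Finset.mem_range] at hk
    rw [integral_const_mul, integral_complex_ofReal, integral_halfPlane]
    congr 5
    push_cast [Nat.cast_sub (show 2 * k ≤ ℓ by omega), Nat.cast_sub (show 1 ≤ 2 * k + n by omega)]
    ring
  have hΓ : ((Real.Gamma (((ℓ : ℝ) + n + 1) / 2) / 2 : ℝ) : ℂ) ≠ 0 := by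
    have := (Real.Gamma_pos_of_pos (show 0 < ((ℓ : ℝ) + n + 1) / 2 by positivity)).ne'
    exact_mod_cast div_ne_zero this two_ne_zero
  refine mul_right_cancel₀ hΓ ?_
  rw [← hpolar, hfinal, Finset.sum_mul]
  refine Finset.sum_congr rfl fun k _ => ?_
  push_cast
  ring

theorem integral_sphereSlice (hω : ‖ω‖ = 1) {T : Set ℝ} (hT : MeasurableSet T) {ℓ : ℕ}
    {R : MvPolynomial (Fin (n + 1)) ℂ} (hR : R.IsHomogeneous ℓ) :
    ∫ x in sphereSlice ω T, evalAt R x ∂μHE[n] =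
      ∑ k ∈ Finset.range (ℓ / 2 + 1), (pizzettiCoeff n k : ℂ) *
        ((∫ t in Set.Ioo (-1 : ℝ) 1 ∩ T, capDensity (n + 1) k ℓ t : ℝ) : ℂ) *
        evalAt ((pizzettiOp ω ^ k) R) ω := by
  have hn : 1 ≤ n := NeZero.one_le
  have hH : MeasurableSet {x : EuclideanSpace ℝ (Fin (n + 1)) | inner ℝ x ω ∈ T} :=
    (Continuous.measurable (by fun_prop : Continuous fun x : EuclideanSpace ℝ (Fin (n + 1)) =>
      inner ℝ x ω)) hT
  have h1 : ∫ x in sphereSlice ω T, evalAt R x ∂μHE[n] =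
      ∫ η : Metric.sphere (0 : EuclideanSpace ℝ (Fin (n + 1))) 1,
        ((T.indicator 1 (inner ℝ (η : EuclideanSpace ℝ (Fin (n + 1))) ω) : ℝ) : ℂ) * evalAt R η
        ∂(volume : Measure (EuclideanSpace ℝ (Fin (n + 1)))).toSphere := by
    have e : sphereSlice ω T = Metric.sphere 0 1 ∩
      {x : EuclideanSpace ℝ (Fin (n + 1)) | inner ℝ x ω ∈ T} := rfl
    rw [e, ← setIntegral_indicator hH, restrict_sphere,
      (MeasurableEmbedding.subtype_coe Metric.isClosed_sphere.measurableSet).integral_map]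
    refine integral_congr_ae (.of_forall fun η => ?_)
    by_cases h : inner ℝ (η : EuclideanSpace ℝ (Fin (n + 1))) ω ∈ T
    · simp only
      rw [Set.indicator_of_mem (show (η : EuclideanSpace ℝ (Fin (n + 1))) ∈ {x | inner ℝ x ω ∈ T}
        from h), Set.indicator_of_mem h]
      simp
    · simp only
      rw [Set.indicator_of_notMem (show (η : EuclideanSpace ℝ (Fin (n + 1))) ∉ {x | inner ℝ x ω ∈ T}
        from h), Set.indicator_of_notMem h]
      simp
  rw [h1, integral_toSphere_weight hω (measurable_one.indicator hT) (fun t => ?_) hR]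
  · refine Finset.sum_congr rfl fun k _ => ?_
    congr 3
    rw [← setIntegral_indicator hT, capDensity_eq (by omega)]
    refine setIntegral_congr_fun measurableSet_Ioo fun t _ => ?_
    rw [show 2 * k + (n + 1) - 2 = 2 * k + n - 1 by omega]
    by_cases h : t ∈ T <;> simp [h]
  · by_cases h : t ∈ T <;> simp [h]

end Cap

end SphericalPizzetti

end PizzettiProof

theorem theorem3p1 (m : ℕ) (hm : 2 ≤ m) (ω : EuclideanSpace ℝ (Fin m)) (hω : ‖ω‖ = 1)
    (p : ℝ) (hp0 : 0 ≤ p) (hp1 : p < 1) :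
    -- (i) the sub-sphere, with its (m-2)-dimensional surface measure
    (∀ R : MvPolynomial (Fin m) ℂ,
      IntegrableOn (SphericalPizzetti.evalAt R) (SphericalPizzetti.subSphere ω p) μHE[m - 2] ∧
      HasSum
        (fun k : ℕ =>
          ((2 * π ^ (((m : ℝ) - 1) / 2) /
              (2 ^ (2 * k) * (k ! : ℝ) * Real.Gamma (((m : ℝ) - 1) / 2 + k)) : ℝ) : ℂ) *
            SphericalPizzetti.evalAt ((SphericalPizzetti.pizzettiOp ω ^ k) R) (p • ω) *
            (((1 - p ^ 2) ^ ((k : ℝ) + (m : ℝ) / 2 - 1) : ℝ) : ℂ))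
        (∫ x in SphericalPizzetti.subSphere ω p, SphericalPizzetti.evalAt R x ∂μHE[m - 2])) ∧
    -- (ii) the sub-ball, with the (m-1)-dimensional Lebesgue measure of the hyperplane
    (∀ R : MvPolynomial (Fin m) ℂ,
      IntegrableOn (SphericalPizzetti.evalAt R) (SphericalPizzetti.subBall ω p) μHE[m - 1] ∧
      HasSum
        (fun k : ℕ =>
          ((π ^ (((m : ℝ) - 1) / 2) /
              (2 ^ (2 * k) * (k ! : ℝ) * Real.Gamma (((m : ℝ) + 1) / 2 + k)) : ℝ) : ℂ) *
            SphericalPizzetti.evalAt ((SphericalPizzetti.pizzettiOp ω ^ k) R) (p • ω) *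
            (((1 - p ^ 2) ^ ((k : ℝ) + ((m : ℝ) - 1) / 2) : ℝ) : ℂ))
        (∫ x in SphericalPizzetti.subBall ω p, SphericalPizzetti.evalAt R x ∂μHE[m - 1])) ∧
    -- (iii) the upper cap, with the (m-1)-dimensional surface measure
    (∀ (ℓ : ℕ) (R : MvPolynomial (Fin m) ℂ), R.IsHomogeneous ℓ →
      IntegrableOn (SphericalPizzetti.evalAt R) (SphericalPizzetti.upperCap ω p) μHE[m - 1] ∧
      ∫ x in SphericalPizzetti.upperCap ω p, SphericalPizzetti.evalAt R x ∂μHE[m - 1] =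
        ∑ k ∈ Finset.range (ℓ / 2 + 1),
          ((2 * π ^ (((m : ℝ) - 1) / 2) /
              (2 ^ (2 * k) * (k ! : ℝ) * Real.Gamma (((m : ℝ) - 1) / 2 + k)) : ℝ) : ℂ) *
            (SphericalPizzetti.upperCoeff m k ℓ p : ℂ) *
            SphericalPizzetti.evalAt ((SphericalPizzetti.pizzettiOp ω ^ k) R) ω) ∧
    (∀ k ℓ : ℕ, 2 * k ≤ ℓ →
      IntervalIntegrable (SphericalPizzetti.capDensity m k ℓ) volume p 1 ∧
      SphericalPizzetti.upperCoeff m k ℓ p =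
        Real.Gamma (((ℓ : ℝ) + 1) / 2 - k) * Real.Gamma ((k : ℝ) + ((m : ℝ) - 1) / 2) /
            (2 * Real.Gamma (((ℓ : ℝ) + m) / 2)) -
          p ^ (ℓ - 2 * k + 1) / ((ℓ : ℝ) - 2 * k + 1) *
            ordinaryHypergeometric (-(k : ℝ) - ((m : ℝ) - 3) / 2) (((ℓ : ℝ) + 1) / 2 - k)
              (((ℓ : ℝ) + 3) / 2 - k) (p ^ 2)) ∧
    -- (iv) the lower cap, with the (m-1)-dimensional surface measure
    (∀ (ℓ : ℕ) (R : MvPolynomial (Fin m) ℂ), R.IsHomogeneous ℓ →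
      IntegrableOn (SphericalPizzetti.evalAt R) (SphericalPizzetti.lowerCap ω p) μHE[m - 1] ∧
      ∫ x in SphericalPizzetti.lowerCap ω p, SphericalPizzetti.evalAt R x ∂μHE[m - 1] =
        ∑ k ∈ Finset.range (ℓ / 2 + 1),
          ((2 * π ^ (((m : ℝ) - 1) / 2) /
              (2 ^ (2 * k) * (k ! : ℝ) * Real.Gamma (((m : ℝ) - 1) / 2 + k)) : ℝ) : ℂ) *
            (SphericalPizzetti.lowerCoeff m k ℓ p : ℂ) *
            SphericalPizzetti.evalAt ((SphericalPizzetti.pizzettiOp ω ^ k) R) ω) ∧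
    (∀ k ℓ : ℕ, 2 * k ≤ ℓ →
      IntervalIntegrable (SphericalPizzetti.capDensity m k ℓ) volume (-1) p ∧
      SphericalPizzetti.lowerCoeff m k ℓ p =
        p ^ (ℓ - 2 * k + 1) / ((ℓ : ℝ) - 2 * k + 1) *
            ordinaryHypergeometric (-(k : ℝ) - ((m : ℝ) - 3) / 2) (((ℓ : ℝ) + 1) / 2 - k)
              (((ℓ : ℝ) + 3) / 2 - k) (p ^ 2) +
          (-1) ^ ℓ *
            (Real.Gamma (((ℓ : ℝ) + 1) / 2 - k) * Real.Gamma ((k : ℝ) + ((m : ℝ) - 1) / 2) /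
              (2 * Real.Gamma (((ℓ : ℝ) + m) / 2)))) := by
  obtain ⟨n, rfl⟩ : ∃ n, m = n + 1 := ⟨m - 1, by omega⟩
  have hn : NeZero n := ⟨by omega⟩
  have hcast : (((n + 1 : ℕ) : ℝ) - 1) / 2 = (n : ℝ) / 2 := by push_cast; ring
  have hn0 : (0 : ℝ) < n := by exact_mod_cast NeZero.pos n
  simp only [show n + 1 - 2 = n - 1 by omega, Nat.add_sub_cancel]
  have hupper : ∀ k ℓ : ℕ, ∫ t in Set.Ioo (-1 : ℝ) 1 ∩ Set.Ioi p,
      SphericalPizzetti.capDensity (n + 1) k ℓ t =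
        SphericalPizzetti.upperCoeff (n + 1) k ℓ p := fun k ℓ => by
    rw [SphericalPizzetti.upperCoeff, Set.Ioo_inter_Ioi, sup_of_le_right (by linarith),
      intervalIntegral.integral_of_le hp1.le, integral_Ioc_eq_integral_Ioo]
  have hlower : ∀ k ℓ : ℕ, ∫ t in Set.Ioo (-1 : ℝ) 1 ∩ Set.Iio p,
      SphericalPizzetti.capDensity (n + 1) k ℓ t =
        SphericalPizzetti.lowerCoeff (n + 1) k ℓ p := fun k ℓ => by
    rw [SphericalPizzetti.lowerCoeff, Set.Ioo_inter_Iio, inf_of_le_right hp1.le,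
      intervalIntegral.integral_of_le (by linarith), integral_Ioc_eq_integral_Ioo]
  have hint : ∀ (k ℓ : ℕ) {a b : ℝ}, -1 ≤ a → a ≤ b → b ≤ 1 →
      IntervalIntegrable (SphericalPizzetti.capDensity (n + 1) k ℓ) volume a b :=
    fun k ℓ _ _ ha hab hb => SphericalPizzetti.intervalIntegrable_capDensity hm k ℓ ha hab hb
  refine ⟨fun R => ⟨SphericalPizzetti.integrableOn_subSphere hω hp0 hp1 R, ?_⟩,
    fun R => ⟨SphericalPizzetti.integrableOn_subBall hω hp0 hp1 R, ?_⟩,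
    fun ℓ R hR => ⟨SphericalPizzetti.integrableOn_sphereSlice (Set.Ioi p) R, ?_⟩,
    fun k ℓ hk => ⟨hint k ℓ (by linarith) hp1.le le_rfl, ?_⟩,
    fun ℓ R hR => ⟨SphericalPizzetti.integrableOn_sphereSlice (Set.Iio p) R, ?_⟩,
    fun k ℓ hk => ⟨hint k ℓ le_rfl (by linarith) hp1.le, ?_⟩⟩
  · refine (SphericalPizzetti.hasSum_subSphere hω hp0 hp1 R).congr_fun fun k => ?_
    rw [SphericalPizzetti.pizzettiCoeff, hcast]
    congr 4
    push_cast
    ring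
  · refine (SphericalPizzetti.hasSum_subBall hω hp0 hp1 R).congr_fun fun k => ?_
    rw [hcast]
    congr 3
    have hne : (n : ℝ) / 2 + k ≠ 0 := by positivity
    have hΓ : Real.Gamma ((n : ℝ) / 2 + k) ≠ 0 := (Real.Gamma_pos_of_pos (by positivity)).ne'
    have hne' : (n : ℝ) + 2 * k ≠ 0 := by positivity
    rw [SphericalPizzetti.pizzettiCoeff,
      show (((n + 1 : ℕ) : ℝ) + 1) / 2 + k = ((n : ℝ) / 2 + k) + 1 by push_cast; ring,
      Real.Gamma_add_one hne]
    generalize Real.Gamma ((n : ℝ) / 2 + k) = G at hΓ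
    field_simp
  · refine (SphericalPizzetti.integral_sphereSlice hω measurableSet_Ioi hR).trans ?_
    refine Finset.sum_congr rfl fun k _ => ?_
    rw [hupper, SphericalPizzetti.pizzettiCoeff, hcast]
  · rw [← SphericalPizzetti.integral_zero_one_capDensity hm hk,
      ← SphericalPizzetti.integral_zero_capDensity hk hp0 hp1, SphericalPizzetti.upperCoeff,
      eq_sub_iff_add_eq, add_comm]
    exact intervalIntegral.integral_add_adjacent_intervals
      (hint k ℓ (by norm_num) hp0 hp1.le) (hint k ℓ (by linarith) hp1.le le_rfl)
  · refine (SphericalPizzetti.integral_sphereSlice hω measurableSet_Iio hR).trans ?_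
    refine Finset.sum_congr rfl fun k _ => ?_
    rw [hlower, SphericalPizzetti.pizzettiCoeff, hcast]
  · rw [← SphericalPizzetti.integral_zero_one_capDensity hm hk,
      ← SphericalPizzetti.integral_zero_capDensity hk hp0 hp1,
      ← SphericalPizzetti.integral_neg_one_zero_capDensity hk, SphericalPizzetti.lowerCoeff]
    refine Eq.trans ?_ (add_comm _ _)
    exact (intervalIntegral.integral_add_adjacent_intervals
      (hint k ℓ le_rfl (by norm_num) zero_le_one) (hint k ℓ (by norm_num) hp0 hp1.le)).symm
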